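/- Let $\mathfrak g$ be a real nilpotent Lie algebra of dimension $8$, with ascending central series $\mathfrak g_0=\{0\}$, $\mathfrak g_k=\{X\in\mathfrak g : [X,\mathfrak g]\subseteq\mathfrak g_{k-1}\}$ for $k\ge 1$. Let $J$ be a complex structure on $\mathfrak g$, that is, an endomorphism $J\colon\mathfrak g\to\mathfrak g$ with $J^2=-\mathrm{Id}$ and $[X,Y]+J[JX,Y]+J[X,JY]-[JX,JY]=0$ for all $X,Y\in\mathfrak g$. Suppose that $J$ is strongly non-nilpotent (SnN): the subspace $\mathfrak a_1(J)=\{X\in\mathfrak g : [X,\mathfrak g]=0 \text{ and } [JX,\mathfrak g]=0\}$ is $\{0\}$. Call $(\mathcal V_1,\mathcal V_2,\mathcal V_3,\mathcal V_4)$ an adapted splitting if the $\mathcal V_i$ are $2$-dimensional $J$-invariant subspaces of $\mathfrak g$ such that $\mathfrak g=\mathcal V_1\oplus\mathcal V_2\oplus\mathcal V_3\oplus\mathcal V_4$ as a vector space and $\mathfrak g_1\subseteq\mathcal V_1$. All direct sums below are direct sums of vector subspaces. 1. If $\dim\mathfrak g_2=3$, then $\dim\mathfrak g_1=1$ and there is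 an adapted splitting such that $\mathfrak g_2=\mathfrak g_1\oplus\mathcal V_2$ and one of the following holds: - (i) $\mathfrak g_3=\mathfrak g$; - (ii) $\mathfrak g_3=\mathcal V_1\oplus\mathcal V_2\oplus\mathcal V_3$ and $\mathfrak g_4=\mathfrak g$; - (iii) $\mathfrak g_3=\mathfrak g_1\oplus\mathcal V_2\oplus\mathcal V_3$ and $\mathfrak g_4=\mathfrak g$; - (iv) $\mathfrak g_3=\mathfrak g_1\oplus\mathcal V_2\oplus\mathcal V_3$, $\mathfrak g_4=\mathcal V_1\oplus\mathcal V_2\oplus\mathcal V_3$ and $\mathfrak g_5=\mathfrak g$. 2. If $\dim\mathfrak g_2=4$, then $\dim\mathfrak g_1=1$; there are an adapted splitting and a vector $Y\in\mathcal V_3$ with $Y\notin J\mathfrak g_1$ such that $\mathfrak g_2=\mathfrak g_1\oplus\mathcal V_2\oplus\langle Y\rangle$; and $\mathfrak g_3$ is $J$-invariant with $\dim\mathfrak g_3=6$ or $8$. 3. If $\dim\mathfrak g_2=5$, then $\dim\mathfrak g_1=1$; there is an adapted splitting such that $\mathfrak g_2=\mathfrak g_1\oplus\mathcal V_2\oplus\mathcal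 V_3$; and $\mathfrak g_3$ is $J$-invariant. -/

import Mathlib

open Module

namespace NLA

variable {𝔤 : Type*} [LieRing 𝔤] [LieAlgebra ℝ 𝔤]

variable (𝔤) in
/-- The `k`-th term `𝔤_k` of the ascending central series of a real Lie algebra `𝔤`:
`𝔤_0 = 0` and `𝔤_{k+1} = {x | [x, 𝔤] ⊆ 𝔤_k}`. -/
def ascendingSeries (k : ℕ) : Submodule ℝ 𝔤 :=
  ((⊥ : LieIdeal ℝ 𝔤).ucs k).toSubmodule

theorem ascendingSeries_zero : ascendingSeries 𝔤 0 = ⊥ := by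
  simp [ascendingSeries]

theorem mem_ascendingSeries_succ (k : ℕ) (x : 𝔤) :
    x ∈ ascendingSeries 𝔤 (k + 1) ↔ ∀ y : 𝔤, ⁅x, y⁆ ∈ ascendingSeries 𝔤 k := by
  simp only [ascendingSeries, LieSubmodule.mem_toSubmodule, LieSubmodule.ucs_succ,
    LieSubmodule.mem_normalizer]
  refine forall_congr' fun y => ?_
  rw [← lie_skew x y, neg_mem_iff]

/-- A complex structure on `𝔤`: an endomorphism with `J² = -Id` and vanishing Nijenhuis tensor. -/
structure IsComplexStructure (J : 𝔤 →ₗ[ℝ] 𝔤) : Prop where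
  sq_eq_neg : ∀ x, J (J x) = -x
  nijenhuis : ∀ x y, ⁅x, y⁆ + J ⁅J x, y⁆ + J ⁅x, J y⁆ - ⁅J x, J y⁆ = 0

/-- The ascending `J`-compatible series `𝔞_k(J)`: `𝔞_0(J) = 0` and
`𝔞_{k+1}(J) = {x | [x, 𝔤] ⊆ 𝔞_k(J) and [J x, 𝔤] ⊆ 𝔞_k(J)}`. -/
def compatibleSeries (J : 𝔤 →ₗ[ℝ] 𝔤) : ℕ → Submodule ℝ 𝔤
  | 0 => ⊥
  | k + 1 =>
    { carrier := {x | (∀ y, ⁅x, y⁆ ∈ compatibleSeries J k) ∧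
        ∀ y, ⁅J x, y⁆ ∈ compatibleSeries J k}
      zero_mem' := by simp
      add_mem' := fun {a b} ha hb =>
        ⟨fun y => by rw [add_lie]; exact add_mem (ha.1 y) (hb.1 y),
          fun y => by rw [map_add, add_lie]; exact add_mem (ha.2 y) (hb.2 y)⟩
      smul_mem' := fun c x hx =>
        ⟨fun y => by rw [smul_lie]; exact Submodule.smul_mem _ c (hx.1 y),
          fun y => by rw [map_smul, smul_lie]; exact Submodule.smul_mem _ c (hx.2 y)⟩ }

/-- `J` is strongly non-nilpotent (SnN): `𝔞_1(J) = 0`. -/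
def IsSnN (J : 𝔤 →ₗ[ℝ] 𝔤) : Prop :=
  compatibleSeries J 1 = ⊥

/-- `W` is `J`-invariant. -/
def IsJInvariant (J : 𝔤 →ₗ[ℝ] 𝔤) (W : Submodule ℝ 𝔤) : Prop :=
  ∀ x ∈ W, J x ∈ W

/-- `W = ⨁ i, U i` as an internal direct sum of vector subspaces. -/
def IsDirectSum {ι : Type*} (W : Submodule ℝ 𝔤) (U : ι → Submodule ℝ 𝔤) : Prop :=
  iSupIndep U ∧ ⨆ i, U i = W

/-- `𝔤 = V₁ ⊕ V₂ ⊕ V₃ ⊕ V₄` as a vector space, each `Vᵢ` is a `J`-invariant plane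
(so `Vᵢ = ⟨Xᵢ, J Xᵢ⟩` for a `J`-adapted basis `{Xᵢ, J Xᵢ}`), and `𝔤_1 ⊆ V₁`. -/
structure IsAdaptedSplitting (J : 𝔤 →ₗ[ℝ] 𝔤) (V₁ V₂ V₃ V₄ : Submodule ℝ 𝔤) : Prop where
  directSum : IsDirectSum ⊤ ![V₁, V₂, V₃, V₄]
  finrank_eq : ∀ i, finrank ℝ (![V₁, V₂, V₃, V₄] i) = 2
  invariant : ∀ i, IsJInvariant J (![V₁, V₂, V₃, V₄] i)
  center_le : ascendingSeries 𝔤 1 ≤ V₁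

end NLA

open NLA

/-!
Write `𝔤ₖ` for the ascending central series. The Nijenhuis identity makes `ad (J z)` complex linear
for central `z`, and strong non-nilpotency gives `𝔤₁ ∩ J 𝔤₁ = 0`, hence also `𝔤₂ ∩ J 𝔤₁ = 0`.
Two elementary facts about nilpotent Lie algebras do most of the work. The first is a form of
Engel's theorem, `exists_mem_notMem_forall_lie_mem`: an ideal `A` not contained in a subspace `B`
has an element `x ∉ B` with `[x, 𝔤] ⊆ B`. The second is that an ideal of codimension at most two
contains `[𝔤, 𝔤]`. Also, `𝔤₂` commutes with `[𝔤, 𝔤]`, and in particular with `[J z, 𝔤]`.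

*The center.* Some `J z ≠ 0` with `z` central commutes with `𝔤₂`, so the complex subspace
`V = 𝔤₂ + J 𝔤₂` lies in the kernel of `ad (J z)` and has dimension at most six. As `V` contains
`𝔤₁ + J 𝔤₁` and a further complex line, `dim 𝔤₁ ≤ 2`. Dimension two is excluded by
`lie_map_center_two_eq_zero_of_finrank_center_eq_two` and `finrank_center_ne_two`. So `𝔤₁` is
spanned by some `z`, and `J z` commutes with `V`; since `J z ∉ V ∩ 𝔤_k` for the step `k` before
`J z` enters the series, dimension counts become available.

*`dim 𝔤₂ ≥ 4`.* Here `V` is an ideal of codimension two, and `𝔤₂ ∩ J 𝔤₂` has dimension two or four,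
which gives the splitting. The `J`-invariance of `𝔤₃` follows from `V ⊆ 𝔤₃`, because no `𝔤ₖ` has
codimension one. The inclusion is immediate when `dim 𝔤₂ = 5`; when `dim 𝔤₂ = 4` it comes from
`[J z, 𝔤]` meeting `𝔤₂` nontrivially, which by `map_lie_mem_two` forces `[J z, 𝔤] ⊆ 𝔤₂`.

*`dim 𝔤₂ = 3`.* By `exists_map_mem_two_of_three`, `𝔤₂` is the sum of `𝔤₁` and a complex line. If
`J z ∈ 𝔤₃`, then `𝔤₃` contains the centralizer of `J z`, which is complex of codimension two
(`exists_sup_complexLine_le_three`). If `J z ∉ 𝔤₃`, then `𝔤₃` is the sum of `𝔤₂` and a complex line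
`⟨p, J p⟩` with `p ∈ [J z, 𝔤]`, and `J z ∈ 𝔤₄` (`exists_three_eq_sup_complexLine`). In both cases
the next terms of the series are determined up to the alternatives of the theorem, since a term
containing a subspace of codimension two is equal to it or is everything.
-/

namespace NLA

variable {𝔤 : Type*} [LieRing 𝔤] [LieAlgebra ℝ 𝔤]

/-! ### The ascending central series -/

theorem lie_mem_of_mem_succ {k : ℕ} {x : 𝔤} (hx : x ∈ ascendingSeries 𝔤 (k + 1)) (y : 𝔤) :
    ⁅x, y⁆ ∈ ascendingSeries 𝔤 k :=
  (mem_ascendingSeries_succ k x).1 hx y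

theorem lie_mem_of_mem_succ' {k : ℕ} {x : 𝔤} (hx : x ∈ ascendingSeries 𝔤 (k + 1)) (y : 𝔤) :
    ⁅y, x⁆ ∈ ascendingSeries 𝔤 k := by
  rw [← lie_skew]
  exact neg_mem (lie_mem_of_mem_succ hx y)

theorem lie_mem_ascendingSeries (k : ℕ) :
    ∀ x ∈ ascendingSeries 𝔤 k, ∀ y : 𝔤, ⁅x, y⁆ ∈ ascendingSeries 𝔤 k := by
  induction k with
  | zero => intro x hx y; simp_all [ascendingSeries_zero]
  | succ k ih =>
    intro x hx y
    rw [mem_ascendingSeries_succ]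
    exact ih _ (lie_mem_of_mem_succ hx y)

theorem ascendingSeries_mono : Monotone (ascendingSeries 𝔤) :=
  monotone_nat_of_le_succ fun k _ hx =>
    (mem_ascendingSeries_succ k _).2 (lie_mem_ascendingSeries k _ hx)

theorem lie_eq_zero_of_mem_center {x : 𝔤} (hx : x ∈ ascendingSeries 𝔤 1) (y : 𝔤) :
    ⁅x, y⁆ = 0 := by
  simpa [ascendingSeries_zero] using lie_mem_of_mem_succ hx y

theorem lie_eq_zero_of_mem_center' {x : 𝔤} (hx : x ∈ ascendingSeries 𝔤 1) (y : 𝔤) :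
    ⁅y, x⁆ = 0 := by
  simpa [ascendingSeries_zero] using lie_mem_of_mem_succ' hx y

theorem mem_center_of_forall {x : 𝔤} (hx : ∀ y : 𝔤, ⁅x, y⁆ = 0) : x ∈ ascendingSeries 𝔤 1 := by
  rw [mem_ascendingSeries_succ]
  intro y
  rw [hx y]
  exact zero_mem _

/-- The second term of the ascending central series commutes with the derived algebra. -/
theorem lie_lie_eq_zero_of_mem_two {x : 𝔤} (hx : x ∈ ascendingSeries 𝔤 2) (y w : 𝔤) :
    ⁅x, ⁅y, w⁆⁆ = 0 := by
  rw [leibniz_lie, lie_eq_zero_of_mem_center (lie_mem_of_mem_succ hx y),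
    lie_eq_zero_of_mem_center' (lie_mem_of_mem_succ hx w), add_zero]

theorem exists_ascendingSeries_eq_top [LieRing.IsNilpotent 𝔤] :
    ∃ c, ascendingSeries 𝔤 c = ⊤ := by
  obtain ⟨c, hc⟩ := (LieModule.isNilpotent_iff_exists_ucs_eq_top (R := ℝ) (L := 𝔤) (M := 𝔤)).1
    inferInstance
  exact ⟨c, by simp [ascendingSeries, hc]⟩

/-- The first step of the ascending central series at which `A` is no longer contained in `B`. -/
theorem exists_first_escape [LieRing.IsNilpotent 𝔤] {A B : Submodule ℝ 𝔤} (h : ¬ A ≤ B) :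
    ∃ l, A ⊓ ascendingSeries 𝔤 l ≤ B ∧ ∃ x ∈ A, x ∈ ascendingSeries 𝔤 (l + 1) ∧ x ∉ B := by
  classical
  obtain ⟨c, hc⟩ := exists_ascendingSeries_eq_top (𝔤 := 𝔤)
  have hex : ∃ k, ¬ A ⊓ ascendingSeries 𝔤 k ≤ B := ⟨c, by simpa [hc] using h⟩
  obtain ⟨l, hl⟩ : ∃ l, Nat.find hex = l + 1 := by
    refine Nat.exists_eq_succ_of_ne_zero fun h0 => ?_
    have := Nat.find_spec hex
    rw [h0, ascendingSeries_zero] at this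
    simp at this
  refine ⟨l, not_not.1 (Nat.find_min hex (by omega)), ?_⟩
  have := Nat.find_spec hex
  rw [hl, SetLike.not_le_iff_exists] at this
  obtain ⟨x, hx, hxB⟩ := this
  exact ⟨x, hx.1, hx.2, hxB⟩

/-- Engel's theorem in the form used throughout: an ideal not contained in a subspace `B` has an
element outside `B` whose brackets all lie in `B`. -/
theorem exists_mem_notMem_forall_lie_mem [LieRing.IsNilpotent 𝔤] {A B : Submodule ℝ 𝔤}
    (hA : ∀ x ∈ A, ∀ y : 𝔤, ⁅x, y⁆ ∈ A) (h : ¬ A ≤ B) :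
    ∃ x ∈ A, x ∉ B ∧ ∀ y : 𝔤, ⁅x, y⁆ ∈ B := by
  obtain ⟨l, hl, x, hxA, hx, hxB⟩ := exists_first_escape h
  exact ⟨x, hxA, hxB, fun y => hl ⟨hA x hxA y, lie_mem_of_mem_succ hx y⟩⟩

/-- In a nilpotent Lie algebra an ideal of codimension at most two contains all brackets. -/
theorem lie_mem_of_codim_le_two [LieRing.IsNilpotent 𝔤] {M : Submodule ℝ 𝔤} {p q : 𝔤}
    (hM : ∀ x ∈ M, ∀ y : 𝔤, ⁅x, y⁆ ∈ M)
    (hspan : ∀ y : 𝔤, ∃ m ∈ M, ∃ a b : ℝ, y = m + a • p + b • q) (x y : 𝔤) : ⁅x, y⁆ ∈ M := by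
  have hM' : ∀ x ∈ M, ∀ y : 𝔤, ⁅y, x⁆ ∈ M := fun x hx y => by
    rw [← lie_skew]; exact neg_mem (hM x hx y)
  have hpq : ⁅p, q⁆ ∈ M := by
    by_cases htop : (⊤ : Submodule ℝ 𝔤) ≤ M
    · exact htop trivial
    obtain ⟨w, -, hwM, hw⟩ := exists_mem_notMem_forall_lie_mem (A := ⊤) (fun _ _ _ => trivial) htop
    obtain ⟨m, hm, a, b, rfl⟩ := hspan w
    by_cases ha : a = 0
    · have hb : b ≠ 0 := by
        rintro rfl
        simp [ha, hm] at hwM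
      have h1 := sub_mem (hw p) (hM m hm p)
      have h2 : ⁅m + a • p + b • q, p⁆ - ⁅m, p⁆ = -(b • ⁅p, q⁆) := by
        rw [← lie_skew p q]
        simp only [add_lie, smul_lie, lie_self, ha]
        module
      rw [h2, neg_mem_iff] at h1
      exact (Submodule.smul_mem_iff _ hb).1 h1
    · have h1 := sub_mem (hw q) (hM m hm q)
      have h2 : ⁅m + a • p + b • q, q⁆ - ⁅m, q⁆ = a • ⁅p, q⁆ := by simp
      rw [h2] at h1
      exact (Submodule.smul_mem_iff _ ha).1 h1
  obtain ⟨m, hm, a, b, rfl⟩ := hspan x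
  obtain ⟨m', hm', a', b', rfl⟩ := hspan y
  have key : ⁅m + a • p + b • q, m' + a' • p + b' • q⁆ =
      ⁅m, m' + a' • p + b' • q⁆ + ⁅a • p + b • q, m'⁆ + (a * b' - b * a') • ⁅p, q⁆ := by
    have := lie_skew p q
    simp only [add_lie, lie_add, smul_lie, lie_smul, lie_self, ← this]
    module
  rw [key]
  exact add_mem (add_mem (hM _ hm _) (hM' _ hm' _)) (M.smul_mem _ hpq)

theorem ascendingSeries_succ_eq_top {k : ℕ} (h : ∀ x y : 𝔤, ⁅x, y⁆ ∈ ascendingSeries 𝔤 k) :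
    ascendingSeries 𝔤 (k + 1) = ⊤ :=
  eq_top_iff.2 fun x _ => (mem_ascendingSeries_succ k x).2 (h x)

/-- No term of the ascending central series with positive index has codimension one. -/
theorem ascendingSeries_eq_top_of_codim_le_one {k : ℕ} {q : 𝔤}
    (hspan : ∀ y : 𝔤, ∃ m ∈ ascendingSeries 𝔤 (k + 1), ∃ a : ℝ, y = m + a • q) :
    ascendingSeries 𝔤 (k + 1) = ⊤ := by
  refine ascendingSeries_succ_eq_top fun x y => ?_
  obtain ⟨m, hm, a, rfl⟩ := hspan x
  obtain ⟨m', hm', a', rfl⟩ := hspan y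
  have key : ⁅m + a • q, m' + a' • q⁆ = ⁅m, m' + a' • q⁆ + ⁅a • q, m'⁆ := by
    simp only [add_lie, lie_add, smul_lie, lie_smul, lie_self]
    module
  rw [key]
  exact add_mem (lie_mem_of_mem_succ hm _) (lie_mem_of_mem_succ' hm' _)

/-! ### Subspaces invariant under a complex structure -/

theorem IsJInvariant.sup {J : 𝔤 →ₗ[ℝ] 𝔤} {U U' : Submodule ℝ 𝔤} (h : IsJInvariant J U)
    (h' : IsJInvariant J U') : IsJInvariant J (U ⊔ U') := by
  intro x hx
  obtain ⟨u, hu, v, hv, rfl⟩ := Submodule.mem_sup.1 hx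
  rw [map_add]
  exact Submodule.add_mem_sup (h u hu) (h' v hv)

variable {J : 𝔤 →ₗ[ℝ] 𝔤}

/-- The complex line `⟨x, J x⟩` spanned by `x`. -/
def complexLine (J : 𝔤 →ₗ[ℝ] 𝔤) (x : 𝔤) : Submodule ℝ 𝔤 :=
  Submodule.span ℝ {x, J x}

theorem mem_complexLine {x y : 𝔤} : y ∈ complexLine J x ↔ ∃ a b : ℝ, a • x + b • J x = y :=
  Submodule.mem_span_pair

theorem self_mem_complexLine (x : 𝔤) : x ∈ complexLine J x :=
  Submodule.subset_span (by simp)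

theorem map_mem_complexLine (x : 𝔤) : J x ∈ complexLine J x :=
  Submodule.subset_span (by simp)

theorem complexLine_le {x : 𝔤} {U : Submodule ℝ 𝔤} (hU : IsJInvariant J U) (hx : x ∈ U) :
    complexLine J x ≤ U := by
  rw [complexLine, Submodule.span_le]
  rintro y (rfl | rfl)
  exacts [hx, hU _ hx]

theorem complexLine_isJInvariant (hJ : IsComplexStructure J) (x : 𝔤) :
    IsJInvariant J (complexLine J x) := by
  intro y hy
  obtain ⟨a, b, rfl⟩ := mem_complexLine.1 hy
  refine mem_complexLine.2 ⟨-b, a, ?_⟩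
  simp only [map_add, map_smul, hJ.sq_eq_neg]
  module

theorem sup_map_isJInvariant (hJ : IsComplexStructure J) (U : Submodule ℝ 𝔤) :
    IsJInvariant J (U ⊔ U.map J) := by
  intro x hx
  obtain ⟨u, hu, _, ⟨v, hv, rfl⟩, rfl⟩ := Submodule.mem_sup.1 hx
  rw [map_add, hJ.sq_eq_neg, add_comm]
  exact Submodule.add_mem_sup (neg_mem hv) ⟨u, hu, rfl⟩

theorem inf_map_isJInvariant (hJ : IsComplexStructure J) (U : Submodule ℝ 𝔤) :
    IsJInvariant J (U ⊓ U.map J) := by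
  rintro x ⟨hx, ⟨v, hv, rfl⟩⟩
  exact ⟨by rw [hJ.sq_eq_neg]; exact neg_mem hv, _, hx, rfl⟩

theorem mem_inf_map_iff (hJ : IsComplexStructure J) {U : Submodule ℝ 𝔤} {x : 𝔤} :
    x ∈ U ⊓ U.map J ↔ x ∈ U ∧ J x ∈ U := by
  constructor
  · intro h
    exact ⟨h.1, (inf_map_isJInvariant hJ U x h).1⟩
  · rintro ⟨h1, h2⟩
    exact ⟨h1, ⟨-J x, neg_mem h2, by rw [map_neg, hJ.sq_eq_neg, neg_neg]⟩⟩

theorem map_injective (hJ : IsComplexStructure J) : Function.Injective J := by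
  intro x y h
  have := congrArg J h
  rwa [hJ.sq_eq_neg, hJ.sq_eq_neg, neg_inj] at this

/-- A vector outside a complex subspace is complex linearly independent of it. -/
theorem eq_zero_of_combination_mem (hJ : IsComplexStructure J) {U : Submodule ℝ 𝔤}
    (hU : IsJInvariant J U) {x : 𝔤} (hx : x ∉ U) {a b : ℝ} (h : a • x + b • J x ∈ U) :
    a = 0 ∧ b = 0 := by
  have h1 := sub_mem (U.smul_mem a h) (U.smul_mem b (hU _ h))
  have h2 : a • (a • x + b • J x) - b • J (a • x + b • J x) = (a ^ 2 + b ^ 2) • x := by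
    simp only [map_add, map_smul, hJ.sq_eq_neg]
    module
  rw [h2] at h1
  have h3 : a ^ 2 + b ^ 2 = 0 := by
    by_contra hne
    exact hx ((Submodule.smul_mem_iff _ hne).1 h1)
  constructor <;> nlinarith [sq_nonneg a, sq_nonneg b]

theorem even_finrank_of_isJInvariant [FiniteDimensional ℝ 𝔤] (hJ : IsComplexStructure J)
    {U : Submodule ℝ 𝔤} (hU : IsJInvariant J U) : Even (finrank ℝ U) := by
  have h1 : (J.restrict hU) * (J.restrict hU) = (-1 : ℝ) • (1 : U →ₗ[ℝ] U) := by
    ext x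
    change J (J (x : 𝔤)) = _
    simp [hJ.sq_eq_neg]
  have h2 := congrArg LinearMap.det h1
  rw [map_mul, LinearMap.det_smul, map_one, mul_one] at h2
  by_contra hodd
  rw [Nat.not_even_iff_odd] at hodd
  rw [hodd.neg_one_pow] at h2
  nlinarith [mul_self_nonneg (LinearMap.det (J.restrict hU))]

theorem finrank_complexLine_le [FiniteDimensional ℝ 𝔤] (x : 𝔤) :
    finrank ℝ (complexLine J x) ≤ 2 := by
  classical
  have := finrank_span_finset_le_card (R := ℝ) ({x, J x} : Finset 𝔤)
  simp only [Finset.coe_insert, Finset.coe_singleton] at this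
  exact this.trans Finset.card_le_two

theorem finrank_sup_complexLine [FiniteDimensional ℝ 𝔤] (hJ : IsComplexStructure J)
    {U : Submodule ℝ 𝔤} (hU : IsJInvariant J U) {x : 𝔤} (hx : x ∉ U) :
    finrank ℝ (U ⊔ complexLine J x : Submodule ℝ 𝔤) = finrank ℝ U + 2 := by
  have h1 := even_finrank_of_isJInvariant hJ hU
  have h2 := even_finrank_of_isJInvariant hJ (hU.sup (complexLine_isJInvariant hJ x))
  have h3 : finrank ℝ U < finrank ℝ (U ⊔ complexLine J x : Submodule ℝ 𝔤) :=
    Submodule.finrank_lt_finrank_of_lt (lt_of_le_of_ne le_sup_left fun h =>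
      hx (h ▸ (le_sup_right : complexLine J x ≤ U ⊔ complexLine J x) (self_mem_complexLine x)))
  have h4 := Submodule.finrank_add_le_finrank_add_finrank U (complexLine J x)
  have h5 := finrank_complexLine_le (J := J) x
  grind

theorem finrank_complexLine [FiniteDimensional ℝ 𝔤] (hJ : IsComplexStructure J) {x : 𝔤}
    (hx : x ≠ 0) : finrank ℝ (complexLine J x) = 2 := by
  have := finrank_sup_complexLine hJ (U := ⊥) (fun y hy => by simp_all) (x := x) (by simpa)
  rwa [bot_sup_eq, finrank_bot, zero_add] at this

theorem finrank_sup_complexLine_of_disjoint [FiniteDimensional ℝ 𝔤]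
    (hJ : IsComplexStructure J) {p : 𝔤} (hp : p ≠ 0)
    {U : Submodule ℝ 𝔤} (hU : ∀ x ∈ complexLine J p, x ∈ U → x = 0) :
    finrank ℝ (U ⊔ complexLine J p : Submodule ℝ 𝔤) = finrank ℝ U + 2 := by
  have h1 := Submodule.finrank_sup_add_finrank_inf_eq U (complexLine J p)
  have h2 : U ⊓ complexLine J p = ⊥ := by
    rw [eq_bot_iff]
    exact fun x hx => hU x hx.2 hx.1
  rw [h2, finrank_bot, finrank_complexLine hJ hp] at h1
  omega

theorem mem_sup_complexLine {U : Submodule ℝ 𝔤} {x y : 𝔤} :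
    y ∈ U ⊔ complexLine J x ↔ ∃ u ∈ U, ∃ a b : ℝ, y = u + a • x + b • J x := by
  rw [Submodule.mem_sup]
  constructor
  · rintro ⟨u, hu, v, hv, rfl⟩
    obtain ⟨a, b, rfl⟩ := mem_complexLine.1 hv
    exact ⟨u, hu, a, b, by abel⟩
  · rintro ⟨u, hu, a, b, rfl⟩
    exact ⟨u, hu, _, mem_complexLine.2 ⟨a, b, rfl⟩, by abel⟩

/-- Two complex subspaces `U ≤ U'` of complex codimension one differ by any complex line in `U'`
that is not in `U`. -/
theorem sup_complexLine_eq [FiniteDimensional ℝ 𝔤] (hJ : IsComplexStructure J)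
    {U U' : Submodule ℝ 𝔤} (hU : IsJInvariant J U) (hU' : IsJInvariant J U') (hle : U ≤ U')
    (hfin : finrank ℝ U' ≤ finrank ℝ U + 2) {x : 𝔤} (hxU' : x ∈ U') (hx : x ∉ U) :
    U ⊔ complexLine J x = U' :=
  Submodule.eq_of_le_of_finrank_le (sup_le hle (complexLine_le hU' hxU'))
    (by rw [finrank_sup_complexLine hJ hU hx]; exact hfin)

theorem forall_exists_eq_add [FiniteDimensional ℝ 𝔤] (hJ : IsComplexStructure J)
    {U : Submodule ℝ 𝔤} (hU : IsJInvariant J U) (hfin : finrank ℝ 𝔤 ≤ finrank ℝ U + 2) {x : 𝔤}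
    (hx : x ∉ U) (y : 𝔤) : ∃ u ∈ U, ∃ a b : ℝ, y = u + a • x + b • J x := by
  rw [← mem_sup_complexLine, sup_complexLine_eq hJ hU (U' := ⊤) (fun _ _ => trivial) le_top
    (by simpa using hfin) trivial hx]
  trivial

theorem ascendingSeries_succ_eq_top_of_isJInvariant [FiniteDimensional ℝ 𝔤]
    [LieRing.IsNilpotent 𝔤] (hJ : IsComplexStructure J) {k : ℕ}
    (hk : IsJInvariant J (ascendingSeries 𝔤 k))
    (hfin : finrank ℝ 𝔤 ≤ finrank ℝ (ascendingSeries 𝔤 k) + 2) :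
    ascendingSeries 𝔤 (k + 1) = ⊤ := by
  by_cases htop : ascendingSeries 𝔤 k = ⊤
  · exact top_le_iff.1 (htop ▸ ascendingSeries_mono (Nat.le_succ k))
  · obtain ⟨q, hq⟩ := SetLike.exists_not_mem_of_ne_top _ htop rfl
    exact ascendingSeries_succ_eq_top (lie_mem_of_codim_le_two (lie_mem_ascendingSeries k)
      (forall_exists_eq_add hJ hk hfin hq))

/-- A term of the ascending central series containing a subspace of codimension two is equal to it
or is everything. -/
theorem ascendingSeries_eq_top_or_eq [FiniteDimensional ℝ 𝔤] {k : ℕ} {M : Submodule ℝ 𝔤}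
    (hM : M ≤ ascendingSeries 𝔤 (k + 1)) (hfin : finrank ℝ 𝔤 ≤ finrank ℝ M + 2) :
    ascendingSeries 𝔤 (k + 1) = ⊤ ∨ ascendingSeries 𝔤 (k + 1) = M := by
  by_cases heq : M = ascendingSeries 𝔤 (k + 1)
  · exact Or.inr heq.symm
  left
  by_contra htop
  have h1 := Submodule.finrank_lt_finrank_of_lt (lt_of_le_of_ne hM heq)
  obtain ⟨q, hq⟩ := SetLike.exists_not_mem_of_ne_top _ htop rfl
  refine htop (ascendingSeries_eq_top_of_codim_le_one (q := q) fun y => ?_)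
  have h2 : ascendingSeries 𝔤 (k + 1) ⊔ Submodule.span ℝ {q} = ⊤ := by
    refine Submodule.eq_of_le_of_finrank_le le_top ?_
    have h3 : ascendingSeries 𝔤 (k + 1) < ascendingSeries 𝔤 (k + 1) ⊔ Submodule.span ℝ {q} :=
      lt_of_le_of_ne le_sup_left fun heq =>
        hq (heq ▸ Submodule.mem_sup_right (Submodule.mem_span_singleton_self _))
    have := Submodule.finrank_lt_finrank_of_lt h3
    rw [finrank_top]
    omega
  have hy : y ∈ ascendingSeries 𝔤 (k + 1) ⊔ Submodule.span ℝ {q} := h2 ▸ trivial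
  obtain ⟨m, hm, w, hw, rfl⟩ := Submodule.mem_sup.1 hy
  obtain ⟨a, rfl⟩ := Submodule.mem_span_singleton.1 hw
  exact ⟨m, hm, a, rfl⟩

/-! ### Brackets and the complex structure -/

theorem lie_map_map (hJ : IsComplexStructure J) (x y : 𝔤) :
    ⁅J x, J y⁆ = ⁅x, y⁆ + J (⁅J x, y⁆ + ⁅x, J y⁆) := by
  have := hJ.nijenhuis x y
  rw [sub_eq_zero] at this
  rw [map_add, ← add_assoc, this]

/-- Bracketing with `J z`, for `z` central, is complex linear. -/
theorem lie_map_of_mem_center (hJ : IsComplexStructure J) {z : 𝔤} (hz : z ∈ ascendingSeries 𝔤 1)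
    (y : 𝔤) : ⁅J z, J y⁆ = J ⁅J z, y⁆ := by
  rw [lie_map_map hJ, lie_eq_zero_of_mem_center hz, lie_eq_zero_of_mem_center hz, zero_add,
    add_zero]

theorem eq_zero_of_map_mem_center (hS : IsSnN J) {z : 𝔤} (hz : z ∈ ascendingSeries 𝔤 1)
    (hJz : J z ∈ ascendingSeries 𝔤 1) : z = 0 := by
  have : z ∈ compatibleSeries J 1 :=
    ⟨fun y => by rw [lie_eq_zero_of_mem_center hz]; exact zero_mem _,
      fun y => by rw [lie_eq_zero_of_mem_center hJz]; exact zero_mem _⟩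
  rw [hS] at this
  simpa using this

/-- The second term of the ascending central series meets `J 𝔤₁` trivially. -/
theorem eq_zero_of_map_mem_two (hJ : IsComplexStructure J) (hS : IsSnN J) {z : 𝔤}
    (hz : z ∈ ascendingSeries 𝔤 1) (hJz : J z ∈ ascendingSeries 𝔤 2) : z = 0 := by
  refine eq_zero_of_map_mem_center hS hz (mem_center_of_forall fun y => ?_)
  refine eq_zero_of_map_mem_center hS (lie_mem_of_mem_succ hJz y) ?_
  rw [← lie_map_of_mem_center hJ hz]
  exact lie_mem_of_mem_succ hJz _

theorem add_map_eq_zero (hS : IsSnN J) {a b : 𝔤} (ha : a ∈ ascendingSeries 𝔤 1)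
    (hb : b ∈ ascendingSeries 𝔤 1) (h : a + J b = 0) : a = 0 ∧ b = 0 := by
  have hb0 : b = 0 := eq_zero_of_map_mem_center hS hb (by
    rw [eq_neg_of_add_eq_zero_right h]; exact neg_mem ha)
  subst hb0
  simpa using h

/-- On a complex line contained in `𝔤₂` the bracket is determined by one vector. -/
theorem lie_map_left_of_mem_two (hJ : IsComplexStructure J) (hS : IsSnN J) {x : 𝔤}
    (hx : x ∈ ascendingSeries 𝔤 2) (hJx : J x ∈ ascendingSeries 𝔤 2) (y : 𝔤) :
    ⁅J x, J y⁆ = ⁅x, y⁆ ∧ ⁅J x, y⁆ = -⁅x, J y⁆ := by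
  have h := lie_map_map hJ x y
  have h1 := add_map_eq_zero hS (a := ⁅x, y⁆ - ⁅J x, J y⁆) (b := ⁅J x, y⁆ + ⁅x, J y⁆)
    (sub_mem (lie_mem_of_mem_succ hx _) (lie_mem_of_mem_succ hJx _))
    (add_mem (lie_mem_of_mem_succ hJx _) (lie_mem_of_mem_succ hx _)) (by rw [h]; abel)
  exact ⟨(sub_eq_zero.1 h1.1).symm, eq_neg_of_add_eq_zero_left h1.2⟩

/-! ### The complex hulls of the first two terms of the series -/

/-- The complex subspace `𝔤₁ + J 𝔤₁`. -/
def centerHull (J : 𝔤 →ₗ[ℝ] 𝔤) : Submodule ℝ 𝔤 :=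
  ascendingSeries 𝔤 1 ⊔ (ascendingSeries 𝔤 1).map J

/-- The complex subspace `𝔤₂ + J 𝔤₂`. -/
def secondHull (J : 𝔤 →ₗ[ℝ] 𝔤) : Submodule ℝ 𝔤 :=
  ascendingSeries 𝔤 2 ⊔ (ascendingSeries 𝔤 2).map J

theorem mem_centerHull {x : 𝔤} : x ∈ centerHull J ↔
    ∃ a ∈ ascendingSeries 𝔤 1, ∃ b ∈ ascendingSeries 𝔤 1, x = a + J b := by
  rw [centerHull, Submodule.mem_sup]
  constructor
  · rintro ⟨a, ha, _, ⟨b, hb, rfl⟩, rfl⟩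
    exact ⟨a, ha, b, hb, rfl⟩
  · rintro ⟨a, ha, b, hb, rfl⟩
    exact ⟨a, ha, _, ⟨b, hb, rfl⟩, rfl⟩

theorem mem_secondHull {x : 𝔤} : x ∈ secondHull J ↔
    ∃ a ∈ ascendingSeries 𝔤 2, ∃ b ∈ ascendingSeries 𝔤 2, x = a + J b := by
  rw [secondHull, Submodule.mem_sup]
  constructor
  · rintro ⟨a, ha, _, ⟨b, hb, rfl⟩, rfl⟩
    exact ⟨a, ha, b, hb, rfl⟩
  · rintro ⟨a, ha, b, hb, rfl⟩
    exact ⟨a, ha, _, ⟨b, hb, rfl⟩, rfl⟩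

theorem centerHull_isJInvariant (hJ : IsComplexStructure J) : IsJInvariant J (centerHull J) :=
  sup_map_isJInvariant hJ _

theorem secondHull_isJInvariant (hJ : IsComplexStructure J) : IsJInvariant J (secondHull J) :=
  sup_map_isJInvariant hJ _

theorem center_le_two : ascendingSeries 𝔤 1 ≤ ascendingSeries 𝔤 2 :=
  ascendingSeries_mono (by norm_num)

theorem center_le_centerHull : ascendingSeries 𝔤 1 ≤ centerHull J := le_sup_left

theorem two_le_secondHull : ascendingSeries 𝔤 2 ≤ secondHull J := le_sup_left

theorem map_mem_secondHull {x : 𝔤} (hx : x ∈ ascendingSeries 𝔤 2) : J x ∈ secondHull J :=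
  mem_secondHull.2 ⟨0, zero_mem _, x, hx, by simp⟩

theorem map_mem_centerHull {x : 𝔤} (hx : x ∈ ascendingSeries 𝔤 1) : J x ∈ centerHull J :=
  mem_centerHull.2 ⟨0, zero_mem _, x, hx, by simp⟩

theorem centerHull_le_secondHull : centerHull J ≤ secondHull J :=
  sup_le_sup center_le_two (Submodule.map_mono center_le_two)

theorem mem_center_of_mem_two_of_mem_centerHull (hJ : IsComplexStructure J) (hS : IsSnN J) {x : 𝔤}
    (hx : x ∈ ascendingSeries 𝔤 2) (hW : x ∈ centerHull J) : x ∈ ascendingSeries 𝔤 1 := by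
  obtain ⟨a, ha, b, hb, rfl⟩ := mem_centerHull.1 hW
  have hb0 : b = 0 := eq_zero_of_map_mem_two hJ hS hb
    ((Submodule.add_mem_iff_right _ (center_le_two ha)).1 hx)
  simpa [hb0] using ha

theorem finrank_map_eq (hJ : IsComplexStructure J) (U : Submodule ℝ 𝔤) :
    finrank ℝ (U.map J) = finrank ℝ U :=
  (Submodule.equivMapOfInjective J (map_injective hJ) U).finrank_eq.symm

theorem finrank_centerHull [FiniteDimensional ℝ 𝔤] (hJ : IsComplexStructure J) (hS : IsSnN J) :
    finrank ℝ (centerHull J) = 2 * finrank ℝ (ascendingSeries 𝔤 1) := by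
  have h := Submodule.finrank_sup_add_finrank_inf_eq (ascendingSeries 𝔤 1)
    ((ascendingSeries 𝔤 1).map J)
  have h0 : ascendingSeries 𝔤 1 ⊓ (ascendingSeries 𝔤 1).map J = ⊥ := by
    rw [eq_bot_iff]
    intro x hx
    rw [mem_inf_map_iff hJ] at hx
    exact eq_zero_of_map_mem_center hS hx.1 hx.2
  rw [h0, finrank_bot, add_zero, finrank_map_eq hJ] at h
  rw [centerHull, h]
  ring

theorem lie_map_map_mem_centerHull (hJ : IsComplexStructure J) {x y : 𝔤}
    (hx : x ∈ ascendingSeries 𝔤 2) (hy : y ∈ ascendingSeries 𝔤 2) :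
    ⁅J x, J y⁆ ∈ centerHull J := by
  rw [lie_map_map hJ]
  exact mem_centerHull.2 ⟨_, lie_mem_of_mem_succ hx _, _,
    add_mem (lie_mem_of_mem_succ' hy _) (lie_mem_of_mem_succ hx _), rfl⟩

theorem lie_secondHull_eq_zero (hJ : IsComplexStructure J) {z : 𝔤} (hz : z ∈ ascendingSeries 𝔤 1)
    (h : ∀ x ∈ ascendingSeries 𝔤 2, ⁅J z, x⁆ = 0) : ∀ v ∈ secondHull J, ⁅J z, v⁆ = 0 := by
  intro v hv
  obtain ⟨a, ha, b, hb, rfl⟩ := mem_secondHull.1 hv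
  rw [lie_add, lie_map_of_mem_center hJ hz, h a ha, h b hb, map_zero, add_zero]

theorem map_center_mem_centralizer (hJ : IsComplexStructure J) {t x y : 𝔤}
    (ht : t ∈ ascendingSeries 𝔤 1) (hy : y ∈ ascendingSeries 𝔤 2) : ⁅J ⁅J t, x⁆, y⁆ = 0 := by
  rw [← lie_map_of_mem_center hJ ht, ← lie_skew, lie_lie_eq_zero_of_mem_two hy, neg_zero]

/-- Some nonzero `J z`, with `z` central, commutes with `𝔤₂`: if `J t` does not, then
`z = [J t, x]` will do, since `J z = [J t, J x]` lies in the derived algebra. -/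
theorem exists_center_lie_two_eq_zero [LieRing.IsNilpotent 𝔤] [Nontrivial 𝔤]
    (hJ : IsComplexStructure J) :
    ∃ z ∈ ascendingSeries 𝔤 1, z ≠ 0 ∧ ∀ x ∈ ascendingSeries 𝔤 2, ⁅J z, x⁆ = 0 := by
  obtain ⟨t, -, ht0, ht⟩ := exists_mem_notMem_forall_lie_mem (𝔤 := 𝔤) (A := ⊤) (B := ⊥)
    (fun _ _ _ => trivial) (by simp)
  have htc : t ∈ ascendingSeries 𝔤 1 := mem_center_of_forall fun y => by simpa using ht y
  by_cases h : ∀ x ∈ ascendingSeries 𝔤 2, ⁅J t, x⁆ = 0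
  · exact ⟨t, htc, by simpa using ht0, h⟩
  · push Not at h
    obtain ⟨x, hx, hne⟩ := h
    exact ⟨_, lie_mem_of_mem_succ' hx _, hne, fun y hy => map_center_mem_centralizer hJ htc hy⟩

theorem map_notMem_center (hS : IsSnN J) {z : 𝔤}
    (hz : z ∈ ascendingSeries 𝔤 1) (hz0 : z ≠ 0) : J z ∉ ascendingSeries 𝔤 1 :=
  fun h => hz0 (eq_zero_of_map_mem_center hS hz h)

theorem finrank_secondHull_le [FiniteDimensional ℝ 𝔤] [LieRing.IsNilpotent 𝔤]
    (hJ : IsComplexStructure J) (hS : IsSnN J) (hdim : finrank ℝ 𝔤 = 8) :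
    finrank ℝ (secondHull J) ≤ 6 := by
  have : Nontrivial 𝔤 := Module.nontrivial_of_finrank_pos (R := ℝ) (by omega)
  obtain ⟨z, hz, hz0, h⟩ := exists_center_lie_two_eq_zero hJ
  have hlt : secondHull J < ⊤ := by
    rw [lt_top_iff_ne_top]
    intro htop
    refine map_notMem_center hS hz hz0 (mem_center_of_forall fun y => ?_)
    exact lie_secondHull_eq_zero hJ hz h y (htop ▸ trivial)
  have h1 := Submodule.finrank_lt hlt.ne
  have h2 := even_finrank_of_isJInvariant hJ (secondHull_isJInvariant hJ)
  rw [hdim] at h1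
  grind

theorem exists_mem_two_notMem_center [LieRing.IsNilpotent 𝔤] (h : ascendingSeries 𝔤 1 ≠ ⊤) :
    ∃ x ∈ ascendingSeries 𝔤 2, x ∉ ascendingSeries 𝔤 1 := by
  obtain ⟨x, -, hx, hx'⟩ := exists_mem_notMem_forall_lie_mem (𝔤 := 𝔤) (A := ⊤)
    (B := ascendingSeries 𝔤 1) (fun _ _ _ => trivial) (by simpa using h)
  exact ⟨x, (mem_ascendingSeries_succ 1 x).2 hx', hx⟩

/-- If `𝔤₂ + J 𝔤₂` has complex codimension one, it is an ideal. -/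
theorem lie_mem_secondHull [FiniteDimensional ℝ 𝔤] [LieRing.IsNilpotent 𝔤]
    (hJ : IsComplexStructure J) (hdim : finrank ℝ 𝔤 = 8) (hV : finrank ℝ (secondHull J) = 6) :
    ∀ x ∈ secondHull J, ∀ y : 𝔤, ⁅x, y⁆ ∈ secondHull J := by
  have hVJ := secondHull_isJInvariant hJ
  obtain ⟨q, -, hq, hq'⟩ := exists_mem_notMem_forall_lie_mem (𝔤 := 𝔤) (A := ⊤)
    (B := secondHull J) (fun _ _ _ => trivial) (fun h => by
      rw [top_le_iff] at h
      rw [h, finrank_top, hdim] at hV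
      omega)
  have h1 : ∀ {x : 𝔤}, x ∈ ascendingSeries 𝔤 1 → x ∈ secondHull J :=
    fun hx => two_le_secondHull (center_le_two hx)
  intro x hx y
  obtain ⟨a, ha, b, hb, rfl⟩ := mem_secondHull.1 hx
  rw [add_lie]
  refine add_mem (h1 (lie_mem_of_mem_succ ha _)) ?_
  obtain ⟨v, hv, α, β, rfl⟩ := forall_exists_eq_add hJ hVJ (by omega) hq y
  obtain ⟨c, hc, d, hd, rfl⟩ := mem_secondHull.1 hv
  have h2 : ⁅J b, q⁆ ∈ secondHull J := by rw [← lie_skew]; exact neg_mem (hq' _)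
  have h3 : ⁅J b, J q⁆ ∈ secondHull J := by
    rw [lie_map_map hJ]
    exact add_mem (h1 (lie_mem_of_mem_succ hb _))
      (hVJ _ (add_mem h2 (h1 (lie_mem_of_mem_succ hb _))))
  rw [lie_add, lie_add, lie_add, lie_smul, lie_smul]
  exact add_mem (add_mem (add_mem (h1 (lie_mem_of_mem_succ' hc _))
    (centerHull_le_secondHull (lie_map_map_mem_centerHull hJ hb hd)))
    (Submodule.smul_mem _ _ h2)) (Submodule.smul_mem _ _ h3)

/-- If `dim 𝔤₂ = 5`, then `𝔤₂ + J 𝔤₂ ⊆ 𝔤₃`. -/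
theorem secondHull_le_three_of_five [FiniteDimensional ℝ 𝔤] [LieRing.IsNilpotent 𝔤]
    (hJ : IsComplexStructure J) (hdim : finrank ℝ 𝔤 = 8) (hV : finrank ℝ (secondHull J) = 6)
    (h5 : finrank ℝ (ascendingSeries 𝔤 2) = 5) : secondHull J ≤ ascendingSeries 𝔤 3 := by
  obtain ⟨x, hxV, hx2, hx⟩ := exists_mem_notMem_forall_lie_mem (lie_mem_secondHull hJ hdim hV)
    (B := ascendingSeries 𝔤 2) (fun hle => by
      have := Submodule.finrank_mono hle
      omega)
  have hlt : ascendingSeries 𝔤 2 < secondHull J ⊓ ascendingSeries 𝔤 3 :=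
    lt_of_le_of_ne (le_inf two_le_secondHull (ascendingSeries_mono (by norm_num))) fun heq =>
      hx2 (heq ▸ ⟨hxV, (mem_ascendingSeries_succ 2 x).2 hx⟩)
  have h1 := Submodule.finrank_lt_finrank_of_lt hlt
  exact inf_eq_left.1 (Submodule.eq_of_le_of_finrank_le inf_le_left (by omega))

/-! ### The center is one-dimensional -/

theorem sup_complexLine_eq_secondHull [FiniteDimensional ℝ 𝔤] (hJ : IsComplexStructure J)
    (hS : IsSnN J) (hc : finrank ℝ (ascendingSeries 𝔤 1) = 2) (hV : finrank ℝ (secondHull J) = 6)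
    {x : 𝔤} (hx : x ∈ secondHull J) (hx' : x ∉ centerHull J) {v : 𝔤} (hv : v ∈ secondHull J) :
    ∃ a ∈ ascendingSeries 𝔤 1, ∃ b ∈ ascendingSeries 𝔤 1, ∃ α β : ℝ,
      v = a + J b + α • x + β • J x := by
  rw [← sup_complexLine_eq hJ (centerHull_isJInvariant hJ) (secondHull_isJInvariant hJ)
    centerHull_le_secondHull (by rw [finrank_centerHull hJ hS]; omega) hx hx',
    mem_sup_complexLine] at hv
  obtain ⟨w, hw, α, β, rfl⟩ := hv
  obtain ⟨a, ha, b, hb, rfl⟩ := mem_centerHull.1 hw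
  exact ⟨a, ha, b, hb, α, β, rfl⟩

/-- If the center is two-dimensional, then `J 𝔤₁` commutes with `𝔤₂`. Otherwise
`[J t, x] = z ≠ 0` for some `x ∈ 𝔤₂`, and comparing brackets with `J t` and `x` shows that
`⟨z, J z⟩` is an ideal; this puts `J z` into `𝔤₂`. -/
theorem lie_map_center_two_eq_zero_of_finrank_center_eq_two [FiniteDimensional ℝ 𝔤]
    [LieRing.IsNilpotent 𝔤] (hJ : IsComplexStructure J) (hS : IsSnN J) (hdim : finrank ℝ 𝔤 = 8)
    (hc : finrank ℝ (ascendingSeries 𝔤 1) = 2) (hV : finrank ℝ (secondHull J) = 6) {t x : 𝔤}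
    (ht : t ∈ ascendingSeries 𝔤 1) (hx : x ∈ ascendingSeries 𝔤 2) : ⁅J t, x⁆ = 0 := by
  by_contra hz0
  obtain ⟨z, hzdef⟩ : ∃ z, z = ⁅J t, x⁆ := ⟨_, rfl⟩
  rw [← hzdef] at hz0
  have hz : z ∈ ascendingSeries 𝔤 1 := hzdef ▸ lie_mem_of_mem_succ' hx _
  have hVI := lie_mem_secondHull hJ hdim hV
  have hzV : ∀ v ∈ secondHull J, ⁅J z, v⁆ = 0 := lie_secondHull_eq_zero hJ hz fun y hy => by
    rw [hzdef]; exact map_center_mem_centralizer hJ ht hy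
  have hxW : x ∉ centerHull J := fun h => hz0 (by
    rw [hzdef]
    exact lie_eq_zero_of_mem_center' (mem_center_of_mem_two_of_mem_centerHull hJ hS hx h) _)
  -- `z` and `t` form a basis of the center, and `J z` but not `J t` commutes with `x`
  have hspan : ∀ c ∈ ascendingSeries 𝔤 1, ⁅x, J c⁆ = 0 → ∃ α : ℝ, c = α • z := by
    have hxz : ⁅x, J z⁆ = 0 := by
      rw [← lie_skew, hzV x (two_le_secondHull hx), neg_zero]
    have hxt : ⁅x, J t⁆ = -z := by rw [hzdef, lie_skew]
    have hli : LinearIndependent ℝ ![z, t] := by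
      rw [LinearIndependent.pair_iff]
      intro a b hab
      have h1 : ⁅x, J (a • z + b • t)⁆ = -(b • z) := by
        rw [map_add, map_smul, map_smul, lie_add, lie_smul, lie_smul, hxz, hxt]
        module
      rw [hab, map_zero, lie_zero, eq_comm, neg_eq_zero] at h1
      have hb : b = 0 := (smul_eq_zero.1 h1).resolve_right hz0
      subst hb
      rw [zero_smul, add_zero] at hab
      exact ⟨(smul_eq_zero.1 hab).resolve_right hz0, rfl⟩
    have hsp : Submodule.span ℝ {z, t} = ascendingSeries 𝔤 1 := by
      refine Submodule.eq_of_le_of_finrank_le ?_ ?_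
      · rw [Submodule.span_le]
        rintro y (rfl | rfl)
        exacts [hz, ht]
      · have := finrank_span_eq_card hli
        rw [Matrix.range_cons_cons_empty, Fintype.card_fin] at this
        rw [hc, this]
    intro c hcc hxc
    rw [← hsp, Submodule.mem_span_pair] at hcc
    obtain ⟨α, β, rfl⟩ := hcc
    rw [map_add, map_smul, map_smul, lie_add, lie_smul, lie_smul, hxz, hxt, smul_zero, zero_add,
      smul_neg, neg_eq_zero] at hxc
    have hb : β = 0 := (smul_eq_zero.1 hxc).resolve_right hz0
    exact ⟨α, by simp [hb]⟩
  have hideal : ∀ y, ⁅J z, y⁆ ∈ complexLine J z := by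
    intro y
    have hpV : ⁅J z, y⁆ ∈ secondHull J := hVI _ (map_mem_secondHull (center_le_two hz)) _
    have htp : ⁅J t, ⁅J z, y⁆⁆ = 0 := by
      rw [leibniz_lie, lie_map_of_mem_center hJ ht, lie_eq_zero_of_mem_center' hz, map_zero,
        zero_lie, zero_add]
      refine hzV _ ?_
      exact hVI _ (map_mem_secondHull (center_le_two ht)) _
    have hxp : ⁅x, ⁅J z, y⁆⁆ = 0 := lie_lie_eq_zero_of_mem_two hx _ _
    have hxJp : ⁅x, J ⁅J z, y⁆⁆ = 0 := by
      rw [← lie_map_of_mem_center hJ hz]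
      exact lie_lie_eq_zero_of_mem_two hx _ _
    obtain ⟨a, ha, b, hb, α, β, hp⟩ := sup_complexLine_eq_secondHull hJ hS hc hV
      (two_le_secondHull hx) hxW hpV
    rw [hp] at htp hxp hxJp ⊢
    rw [lie_add, lie_add, lie_add, lie_eq_zero_of_mem_center' ha, lie_map_of_mem_center hJ ht,
      lie_eq_zero_of_mem_center' hb, lie_smul, lie_smul, lie_map_of_mem_center hJ ht, ← hzdef,
      map_zero, zero_add, zero_add, ← map_smul] at htp
    obtain ⟨h1, h2⟩ := add_map_eq_zero hS (Submodule.smul_mem _ _ hz)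
      (Submodule.smul_mem _ _ hz) htp
    have hα : α = 0 := (smul_eq_zero.1 h1).resolve_right hz0
    have hβ : β = 0 := (smul_eq_zero.1 h2).resolve_right hz0
    subst hα hβ
    simp only [zero_smul, add_zero, map_add, hJ.sq_eq_neg, lie_add, lie_neg,
      lie_eq_zero_of_mem_center' ha, lie_eq_zero_of_mem_center' hb, zero_add,
      neg_zero] at hxp hxJp ⊢
    obtain ⟨α, rfl⟩ := hspan a ha hxJp
    obtain ⟨β, rfl⟩ := hspan b hb hxp
    exact mem_complexLine.2 ⟨α, β, by rw [map_smul]⟩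
  obtain ⟨w, hw, hwc, hw2⟩ := exists_mem_notMem_forall_lie_mem (A := complexLine J z)
    (B := ascendingSeries 𝔤 1) (by
      intro w hw y
      obtain ⟨a, b, rfl⟩ := mem_complexLine.1 hw
      rw [add_lie, smul_lie, lie_eq_zero_of_mem_center hz, smul_zero, zero_add, smul_lie]
      exact Submodule.smul_mem _ _ (hideal y))
    (fun h => map_notMem_center hS hz hz0 (h (map_mem_complexLine z)))
  obtain ⟨a, b, rfl⟩ := mem_complexLine.1 hw
  have hb : b ≠ 0 := by
    rintro rfl
    exact hwc (by simpa using Submodule.smul_mem _ a hz)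
  refine hz0 (eq_zero_of_map_mem_two hJ hS hz ((mem_ascendingSeries_succ 1 _).2 fun y => ?_))
  have := hw2 y
  rw [add_lie, smul_lie, lie_eq_zero_of_mem_center hz, smul_zero, zero_add, smul_lie] at this
  exact (Submodule.smul_mem_iff _ hb).1 this

theorem eq_zero_of_add_map_mem {k : ℕ} (hk : 2 ≤ k)
    (hdisj : ∀ z ∈ ascendingSeries 𝔤 1, J z ∈ ascendingSeries 𝔤 k → z = 0) {c d : 𝔤}
    (hc : c ∈ ascendingSeries 𝔤 1) (hd : d ∈ ascendingSeries 𝔤 1)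
    (h : c + J d ∈ ascendingSeries 𝔤 k) : d = 0 :=
  hdisj d hd ((Submodule.add_mem_iff_right _ (ascendingSeries_mono (by omega) hc)).1 h)

/-- The first step of the ascending central series that meets `J 𝔤₁`. -/
theorem exists_first_map_center [LieRing.IsNilpotent 𝔤] (hJ : IsComplexStructure J)
    (hS : IsSnN J) (hc : ascendingSeries 𝔤 1 ≠ ⊥) :
    ∃ k, 2 ≤ k ∧ (∀ z ∈ ascendingSeries 𝔤 1, J z ∈ ascendingSeries 𝔤 k → z = 0) ∧
      ∃ t ∈ ascendingSeries 𝔤 1, t ≠ 0 ∧ J t ∈ ascendingSeries 𝔤 (k + 1) := by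
  obtain ⟨k, hk, _, ⟨t, ht, rfl⟩, htk, ht0⟩ := exists_first_escape
    (A := (ascendingSeries 𝔤 1).map J) (B := ⊥) (by
      intro h
      obtain ⟨z, hz, hz0⟩ := Submodule.exists_mem_ne_zero_of_ne_bot hc
      exact hz0 (map_injective hJ (by rw [map_zero]; exact h ⟨z, hz, rfl⟩)))
  have ht0' : t ≠ 0 := by
    rintro rfl
    simp at ht0
  refine ⟨k, ?_, fun z hz hJz => ?_, t, ht, ht0', htk⟩
  · by_contra hlt
    exact ht0' (eq_zero_of_map_mem_two hJ hS ht (ascendingSeries_mono (by omega) htk))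
  · have := hk ⟨⟨z, hz, rfl⟩, hJz⟩
    rw [Submodule.mem_bot] at this
    exact map_injective hJ (by rw [this, map_zero])

/-- The center of an eight-dimensional algebra with an SnN complex structure is not
two-dimensional. When `J 𝔤₁` commutes with `𝔤₂`, the first `T = J t` entering the series gives
`X = [T, Q]` with `⟨X, J X⟩ ⊆ 𝔤₂`; a second vector of `J 𝔤₁` then turns out, by the Jacobi
identity with `Q` and `J Q`, to be central up to a multiple of `T`. -/
theorem finrank_center_ne_two [FiniteDimensional ℝ 𝔤] [LieRing.IsNilpotent 𝔤]
    (hJ : IsComplexStructure J) (hS : IsSnN J) (hdim : finrank ℝ 𝔤 = 8)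
    (hV : finrank ℝ (secondHull J) = 6) : finrank ℝ (ascendingSeries 𝔤 1) ≠ 2 := by
  intro hc
  have hZ : ∀ {t v : 𝔤}, t ∈ ascendingSeries 𝔤 1 → v ∈ secondHull J → ⁅J t, v⁆ = 0 :=
    fun ht hv => lie_secondHull_eq_zero hJ ht (fun x hx =>
      lie_map_center_two_eq_zero_of_finrank_center_eq_two hJ hS hdim hc hV ht hx) _ hv
  have hVJ := secondHull_isJInvariant hJ
  have hWJ := centerHull_isJInvariant hJ
  have hVI := lie_mem_secondHull hJ hdim hV
  obtain ⟨k, hk, hdisj, t, ht, ht0, htk⟩ := exists_first_map_center hJ hS (by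
    intro h
    rw [h, finrank_bot] at hc
    omega)
  have h1k : ascendingSeries 𝔤 1 ≤ ascendingSeries 𝔤 k := ascendingSeries_mono (by omega)
  have h2k : ascendingSeries 𝔤 2 ≤ ascendingSeries 𝔤 k := ascendingSeries_mono hk
  -- a vector `X = [T, Q]` in `𝔤₂`, where `T = J t`
  obtain ⟨Q, hX2, hX0⟩ : ∃ Q : 𝔤, ⁅J t, Q⁆ ∈ ascendingSeries 𝔤 2 ∧ ⁅J t, Q⁆ ≠ 0 := by
    obtain ⟨Q, hQ⟩ : ∃ Q : 𝔤, ⁅J t, Q⁆ ≠ 0 := by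
      by_contra hcon
      push Not at hcon
      exact map_notMem_center hS ht ht0 (mem_center_of_forall hcon)
    have hPk : ⁅J t, Q⁆ ∈ ascendingSeries 𝔤 k := lie_mem_of_mem_succ htk _
    have hJPk : J ⁅J t, Q⁆ ∈ ascendingSeries 𝔤 k := by
      rw [← lie_map_of_mem_center hJ ht]; exact lie_mem_of_mem_succ htk _
    have hPV : ⁅J t, Q⁆ ∈ secondHull J := hVI _ (map_mem_secondHull (center_le_two ht)) _
    have hPW : ⁅J t, Q⁆ ∉ centerHull J := by
      intro h
      obtain ⟨c, hcc, d, hd, hP⟩ := mem_centerHull.1 h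
      have hd0 : d = 0 := eq_zero_of_add_map_mem hk hdisj hcc hd (hP ▸ hPk)
      subst hd0
      rw [map_zero, add_zero] at hP
      exact hQ (hdisj _ (hP ▸ hcc) hJPk)
    obtain ⟨X, hX, hXc⟩ := exists_mem_two_notMem_center (𝔤 := 𝔤) (by
      intro h
      rw [h, finrank_top] at hc
      omega)
    obtain ⟨c, hcc, d, hd, α, β, rfl⟩ := sup_complexLine_eq_secondHull hJ hS hc hV hPV hPW
      (two_le_secondHull hX)
    have hd0 : d = 0 := by
      refine eq_zero_of_add_map_mem hk hdisj hcc hd ?_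
      have := sub_mem (sub_mem (h2k hX) (Submodule.smul_mem _ α hPk)) (Submodule.smul_mem _ β hJPk)
      convert! this using 1
      abel
    subst hd0
    rw [map_zero, add_zero, add_assoc] at hX hXc
    have key : ⁅J t, α • Q + β • J Q⁆ = α • ⁅J t, Q⁆ + β • J ⁅J t, Q⁆ := by
      rw [lie_add, lie_smul, lie_smul, lie_map_of_mem_center hJ ht]
    refine ⟨α • Q + β • J Q, ?_, ?_⟩
    · rw [key]
      exact (Submodule.add_mem_iff_right _ (center_le_two hcc)).1 hX
    · rw [key]
      intro h0
      rw [h0, add_zero] at hXc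
      exact hXc hcc
  obtain ⟨X, hXdef⟩ : ∃ X, X = ⁅J t, Q⁆ := ⟨_, rfl⟩
  rw [← hXdef] at hX2 hX0
  have hJXdef : ⁅J t, J Q⁆ = J X := by rw [lie_map_of_mem_center hJ ht, hXdef]
  have hJXk : J X ∈ ascendingSeries 𝔤 k := hJXdef ▸ lie_mem_of_mem_succ htk _
  have hXc : X ∉ ascendingSeries 𝔤 1 := fun h => hX0 (hdisj X h hJXk)
  have hXW : X ∉ centerHull J :=
    fun h => hXc (mem_center_of_mem_two_of_mem_centerHull hJ hS hX2 h)
  have hXV := two_le_secondHull (J := J) hX2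
  have hQV : Q ∉ secondHull J := fun h => hX0 (by rw [hXdef, hZ ht h])
  have hspan := forall_exists_eq_add hJ hVJ (by omega) hQV
  have hder := lie_mem_of_codim_le_two hVI hspan
  have hmem : ∀ {h : 𝔤}, h ∈ secondHull J → h ∈ ascendingSeries 𝔤 k →
      ∃ ζ ∈ ascendingSeries 𝔤 1, ∃ α β : ℝ, h = ζ + α • X + β • J X := by
    intro h hhV hhk
    obtain ⟨c, hcc, d, hd, α, β, rfl⟩ := sup_complexLine_eq_secondHull hJ hS hc hV hXV hXW hhV
    have hd0 : d = 0 := by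
      refine eq_zero_of_add_map_mem hk hdisj hcc hd ?_
      have := sub_mem (sub_mem hhk (Submodule.smul_mem _ α (h2k hX2))) (Submodule.smul_mem _ β hJXk)
      convert! this using 1
      abel
    exact ⟨c, hcc, α, β, by rw [hd0, map_zero, add_zero]⟩
  have hJX2 : J X ∈ ascendingSeries 𝔤 2 := by
    obtain ⟨x, ⟨hxV, hxk⟩, hxB, hx⟩ := exists_mem_notMem_forall_lie_mem
      (A := secondHull J ⊓ ascendingSeries 𝔤 k) (B := ascendingSeries 𝔤 1 ⊔ Submodule.span ℝ {X})
      (fun x hx y => ⟨hVI x hx.1 y, lie_mem_ascendingSeries k x hx.2 y⟩) (by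
        intro hle
        have := hle ⟨hVJ _ hXV, hJXk⟩
        obtain ⟨ζ, hζ, w, hw, hw'⟩ := Submodule.mem_sup.1 this
        obtain ⟨a, rfl⟩ := Submodule.mem_span_singleton.1 hw
        have h1 : (-a) • X + (1 : ℝ) • J X ∈ centerHull J := by
          rw [← hw']
          refine center_le_centerHull ?_
          convert! hζ using 1
          module
        exact one_ne_zero (eq_zero_of_combination_mem hJ hWJ hXW h1).2)
    obtain ⟨ζ, hζ, α, β, rfl⟩ := hmem hxV hxk
    have hβ : β ≠ 0 := by
      rintro rfl
      refine hxB (Submodule.mem_sup.2 ⟨ζ, hζ, α • X, ?_, by simp⟩)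
      exact Submodule.smul_mem _ _ (Submodule.mem_span_singleton_self X)
    have hJXB : ∀ y, ⁅J X, y⁆ ∈ ascendingSeries 𝔤 1 ⊔ Submodule.span ℝ {X} := by
      intro y
      have h1 := hx y
      rw [add_lie, add_lie, lie_eq_zero_of_mem_center hζ, zero_add, smul_lie, smul_lie] at h1
      rw [Submodule.add_mem_iff_right _ (Submodule.smul_mem _ _
        (Submodule.mem_sup_left (lie_mem_of_mem_succ hX2 y)))] at h1
      exact (Submodule.smul_mem_iff _ hβ).1 h1
    refine (mem_ascendingSeries_succ 1 _).2 fun y => ?_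
    obtain ⟨ζ₁, hζ₁, w, hw, hw'⟩ := Submodule.mem_sup.1 (hJXB y)
    obtain ⟨a, rfl⟩ := Submodule.mem_span_singleton.1 hw
    obtain ⟨ζ₂, hζ₂, w, hw, hw₂⟩ := Submodule.mem_sup.1 (hJXB (J y))
    obtain ⟨b, rfl⟩ := Submodule.mem_span_singleton.1 hw
    have h1 := lie_map_map hJ X y
    rw [← hw', ← hw₂] at h1
    have h2 : (-b) • X + a • J X ∈ centerHull J := by
      refine mem_centerHull.2 ⟨ζ₂ - ⁅X, y⁆, sub_mem hζ₂ (lie_mem_of_mem_succ hX2 _),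
        -(ζ₁ + ⁅X, J y⁆), neg_mem (add_mem hζ₁ (lie_mem_of_mem_succ hX2 _)), ?_⟩
      simp only [map_add, map_smul, map_neg] at h1 ⊢
      linear_combination (norm := module) h1.symm
    have ha := (eq_zero_of_combination_mem hJ hWJ hXW h2).2
    rw [← hw', ha, zero_smul, add_zero]
    exact hζ₁
  have hstruct := lie_map_left_of_mem_two hJ hS hX2 hJX2
  have hXQ : ⁅X, J Q⁆ = 0 := by
    have h1 := hZ ht (hder Q (J Q))
    rw [leibniz_lie, ← hXdef, hJXdef, ← lie_skew Q (J X), (hstruct Q).2, neg_neg,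
      ← two_smul ℝ] at h1
    exact (smul_eq_zero.1 h1).resolve_left two_ne_zero
  have hJXQ : ⁅J X, Q⁆ = 0 := by rw [(hstruct Q).2, hXQ, neg_zero]
  have hXcomm : ∀ {y : 𝔤}, y ∈ ascendingSeries 𝔤 2 → ⁅X, y⁆ = 0 := by
    intro y hy
    rw [hXdef, ← lie_skew, lie_lie_eq_zero_of_mem_two hy, neg_zero]
  have hu : ⁅X, Q⁆ ≠ 0 := by
    intro hu
    refine hXc (mem_center_of_forall fun y => ?_)
    obtain ⟨v, hv, a, b, rfl⟩ := hspan y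
    obtain ⟨c, hcc, d, hd, α, β, rfl⟩ := sup_complexLine_eq_secondHull hJ hS hc hV hXV hXW hv
    simp only [lie_add, lie_smul, hu, hXQ, hXcomm hJX2, lie_self, lie_eq_zero_of_mem_center' hcc,
      smul_zero, add_zero, zero_add]
    rw [← lie_skew, hZ hd hXV, neg_zero]
  -- a second vector `T' = J d` of `J 𝔤₁`
  obtain ⟨B, hB⟩ : ∃ B : Submodule ℝ 𝔤, B = ascendingSeries 𝔤 1 ⊔ complexLine J X ⊔
    Submodule.span ℝ {J t} := ⟨_, rfl⟩
  have h1B : ascendingSeries 𝔤 1 ≤ B := hB ▸ le_sup_left.trans le_sup_left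
  have hXB : X ∈ B := hB ▸ Submodule.mem_sup_left (Submodule.mem_sup_right (self_mem_complexLine X))
  have hJXB : J X ∈ B :=
    hB ▸ Submodule.mem_sup_left (Submodule.mem_sup_right (map_mem_complexLine X))
  have htB : J t ∈ B := hB ▸ Submodule.mem_sup_right (Submodule.mem_span_singleton_self _)
  have hBmem : ∀ {y : 𝔤}, y ∈ B → ∃ ζ ∈ ascendingSeries 𝔤 1, ∃ a b s : ℝ,
      y = ζ + a • X + b • J X + s • J t := by
    intro y hy
    rw [hB] at hy
    obtain ⟨h, hh, w, hw, rfl⟩ := Submodule.mem_sup.1 hy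
    obtain ⟨s, rfl⟩ := Submodule.mem_span_singleton.1 hw
    obtain ⟨ζ, hζ, a, b, rfl⟩ := mem_sup_complexLine.1 hh
    exact ⟨ζ, hζ, a, b, s, rfl⟩
  have hVB : ¬ secondHull J ≤ B := by
    intro hle
    have h1 := Submodule.finrank_mono hle
    have h2 := Submodule.finrank_add_le_finrank_add_finrank
      (ascendingSeries 𝔤 1 ⊔ complexLine J X) (Submodule.span ℝ {J t})
    have h3 := Submodule.finrank_add_le_finrank_add_finrank (ascendingSeries 𝔤 1) (complexLine J X)
    have h4 := finrank_complexLine_le (J := J) X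
    have h5 := finrank_span_singleton (K := ℝ) (v := J t) (fun h => ht0 (map_injective hJ (by
      rw [h, map_zero])))
    rw [← hB] at h2
    omega
  obtain ⟨x, hxV, hxB, hx⟩ := exists_mem_notMem_forall_lie_mem hVI hVB
  obtain ⟨c, hcc, d, hd, α, β, rfl⟩ := sup_complexLine_eq_secondHull hJ hS hc hV hXV hXW hxV
  have hdB : J d ∉ B := fun h => hxB (add_mem (add_mem (add_mem (h1B hcc) h)
    (B.smul_mem _ hXB)) (B.smul_mem _ hJXB))
  have hdlie : ∀ y, ⁅J d, y⁆ ∈ B := by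
    intro y
    have h1 := sub_mem (sub_mem (hx y) (h1B (Submodule.smul_mem _ α (lie_mem_of_mem_succ hX2 y))))
      (h1B (Submodule.smul_mem _ β (lie_mem_of_mem_succ hJX2 y)))
    convert! h1 using 1
    simp only [add_lie, smul_lie, lie_eq_zero_of_mem_center hcc]
    module
  obtain ⟨ζ, hζ, a, b, s, h1⟩ := hBmem (hdlie Q)
  obtain ⟨ζ', hζ', a', b', s', h2⟩ := hBmem (hdlie (J Q))
  rw [lie_map_of_mem_center hJ hd, h1] at h2
  simp only [map_add, map_smul, hJ.sq_eq_neg] at h2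
  have hζt : ζ = s' • t := by
    rw [← sub_eq_zero]
    refine eq_zero_of_map_mem_two hJ hS (sub_mem hζ (Submodule.smul_mem _ _ ht)) ?_
    have h3 : J (ζ - s' • t) = ζ' + s • t + (a' + b) • X + (b' - a) • J X := by
      rw [map_sub, map_smul]
      linear_combination (norm := module) h2
    rw [h3]
    exact add_mem (add_mem (center_le_two (add_mem hζ' (Submodule.smul_mem _ _ ht)))
      (Submodule.smul_mem _ _ hX2)) (Submodule.smul_mem _ _ hJX2)
  subst hζt
  have hQX : ⁅Q, X⁆ = -⁅X, Q⁆ := (lie_skew _ _).symm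
  have hQJX : ⁅Q, J X⁆ = 0 := by rw [← lie_skew, hJXQ, neg_zero]
  have hQt : ⁅Q, t⁆ = 0 := lie_eq_zero_of_mem_center' ht _
  have hQJt : ⁅Q, J t⁆ = -X := by rw [← lie_skew, hXdef]
  have h3 := hZ hd (hder Q (J Q))
  rw [leibniz_lie, lie_map_of_mem_center hJ hd, h1] at h3
  simp only [map_add, map_smul, hJ.sq_eq_neg, add_lie, smul_lie, lie_add, lie_smul, lie_neg,
    hXQ, (hstruct Q).1, hJXdef, hQX, hQJX, hQt, hQJt, lie_eq_zero_of_mem_center ht] at h3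
  have h4 : (-s') • X + s • J X = -((2 * b) • ⁅X, Q⁆) := by
    linear_combination (norm := module) h3
  have h5 : (-s') • X + s • J X ∈ centerHull J := by
    rw [h4]
    exact neg_mem (Submodule.smul_mem _ _ (center_le_centerHull (lie_mem_of_mem_succ hX2 _)))
  obtain ⟨hs', hs⟩ := eq_zero_of_combination_mem hJ hWJ hXW h5
  rw [neg_eq_zero] at hs'
  subst hs hs'
  have hb : b = 0 := by
    rw [neg_zero, zero_smul, zero_smul, add_zero, eq_comm, neg_eq_zero] at h4
    have := (smul_eq_zero.1 h4).resolve_right hu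
    linarith
  subst hb
  have hcent : d - a • t = 0 := by
    have hda : d - a • t ∈ ascendingSeries 𝔤 1 := sub_mem hd (Submodule.smul_mem _ _ ht)
    refine eq_zero_of_map_mem_center hS hda (mem_center_of_forall fun y => ?_)
    have h6 : ⁅J (d - a • t), Q⁆ = 0 := by
      rw [map_sub, map_smul, sub_lie, smul_lie, h1, ← hXdef]
      module
    obtain ⟨v, hv, p, q, rfl⟩ := hspan y
    rw [lie_add, lie_add, lie_smul, lie_smul, lie_map_of_mem_center hJ hda, h6, hZ hda hv]
    simp
  rw [sub_eq_zero] at hcent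
  exact hdB (by rw [hcent, map_smul]; exact B.smul_mem _ htB)

/-- The center of an eight-dimensional nilpotent Lie algebra with an SnN complex structure is
one-dimensional. -/
theorem finrank_center_eq_one [FiniteDimensional ℝ 𝔤] [LieRing.IsNilpotent 𝔤]
    (hJ : IsComplexStructure J) (hS : IsSnN J) (hdim : finrank ℝ 𝔤 = 8) :
    finrank ℝ (ascendingSeries 𝔤 1) = 1 := by
  have : Nontrivial 𝔤 := Module.nontrivial_of_finrank_pos (R := ℝ) (by omega)
  obtain ⟨z, hz, hz0, -⟩ := exists_center_lie_two_eq_zero hJ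
  have hpos : finrank ℝ (ascendingSeries 𝔤 1) ≠ 0 := by
    intro h
    rw [Submodule.finrank_eq_zero] at h
    rw [h] at hz
    exact hz0 (by simpa using hz)
  obtain ⟨x, hx, hxc⟩ := exists_mem_two_notMem_center (𝔤 := 𝔤) (fun h =>
    map_notMem_center hS hz hz0 (h ▸ trivial))
  have hV := finrank_secondHull_le hJ hS hdim
  have hle : centerHull J ⊔ complexLine J x ≤ secondHull J :=
    sup_le centerHull_le_secondHull
      (complexLine_le (secondHull_isJInvariant hJ) (two_le_secondHull hx))
  have h1 := Submodule.finrank_mono hle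
  rw [finrank_sup_complexLine hJ (centerHull_isJInvariant hJ)
    (fun h => hxc (mem_center_of_mem_two_of_mem_centerHull hJ hS hx h)),
    finrank_centerHull hJ hS] at h1
  have h2 : finrank ℝ (ascendingSeries 𝔤 1) ≠ 2 := fun h2 =>
    finrank_center_ne_two hJ hS hdim (by omega) h2
  omega

/-! ### A generator of the center -/

/-- `z` spans the center, `J z` commutes with `𝔤₂ + J 𝔤₂`, and `J z` first enters the ascending
central series at step `k + 1`, where `k ≥ 2`. -/
structure IsCenterGenerator (J : 𝔤 →ₗ[ℝ] 𝔤) (z : 𝔤) (k : ℕ) : Prop where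
  ne_zero : z ≠ 0
  mem : z ∈ ascendingSeries 𝔤 1
  exists_smul : ∀ x ∈ ascendingSeries 𝔤 1, ∃ c : ℝ, x = c • z
  lie_hull : ∀ v ∈ secondHull J, ⁅J z, v⁆ = 0
  two_le : 2 ≤ k
  map_notMem : J z ∉ ascendingSeries 𝔤 k
  map_mem : J z ∈ ascendingSeries 𝔤 (k + 1)

theorem exists_isCenterGenerator [FiniteDimensional ℝ 𝔤] [LieRing.IsNilpotent 𝔤]
    (hJ : IsComplexStructure J) (hS : IsSnN J) (hdim : finrank ℝ 𝔤 = 8) :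
    ∃ z k, IsCenterGenerator J z k := by
  have : Nontrivial 𝔤 := Module.nontrivial_of_finrank_pos (R := ℝ) (by omega)
  have hc := finrank_center_eq_one hJ hS hdim
  obtain ⟨z, hz, hz0, hlie⟩ := exists_center_lie_two_eq_zero hJ
  have hspan : ∀ x ∈ ascendingSeries 𝔤 1, ∃ c : ℝ, x = c • z := by
    intro x hx
    obtain ⟨c, hc⟩ := (finrank_eq_one_iff_of_nonzero' (⟨z, hz⟩ : ascendingSeries 𝔤 1)
      (by simpa [Subtype.ext_iff] using hz0)).1 hc ⟨x, hx⟩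
    exact ⟨c, (congrArg Subtype.val hc).symm⟩
  obtain ⟨k, hk, hdisj, t, ht, ht0, htk⟩ := exists_first_map_center hJ hS (by
    intro h
    rw [h, finrank_bot] at hc
    omega)
  obtain ⟨c, rfl⟩ := hspan t ht
  rw [map_smul, Submodule.smul_mem_iff _ (left_ne_zero_of_smul ht0)] at htk
  exact ⟨z, k, hz0, hz, hspan, lie_secondHull_eq_zero hJ hz hlie, hk,
    fun h => hz0 (hdisj z hz h), htk⟩

namespace IsCenterGenerator

variable {z : 𝔤} {k : ℕ}

theorem one_le (h : IsCenterGenerator J z k) : ascendingSeries 𝔤 1 ≤ ascendingSeries 𝔤 k :=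
  ascendingSeries_mono (by have := h.two_le; omega)

theorem two_le' (h : IsCenterGenerator J z k) : ascendingSeries 𝔤 2 ≤ ascendingSeries 𝔤 k :=
  ascendingSeries_mono h.two_le

theorem mem_center_of_mem_centerHull (h : IsCenterGenerator J z k) {x : 𝔤}
    (hx : x ∈ centerHull J) (hxk : x ∈ ascendingSeries 𝔤 k) : x ∈ ascendingSeries 𝔤 1 := by
  obtain ⟨a, ha, b, hb, rfl⟩ := mem_centerHull.1 hx
  obtain ⟨c, rfl⟩ := h.exists_smul b hb
  rw [Submodule.add_mem_iff_right _ (h.one_le ha), map_smul] at hxk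
  by_cases hc : c = 0
  · simpa [hc] using ha
  · exact absurd ((Submodule.smul_mem_iff _ hc).1 hxk) h.map_notMem

theorem lie_mem (h : IsCenterGenerator J z k) (y : 𝔤) : ⁅J z, y⁆ ∈ ascendingSeries 𝔤 k :=
  lie_mem_of_mem_succ h.map_mem y

theorem map_lie_mem (h : IsCenterGenerator J z k) (hJ : IsComplexStructure J) (y : 𝔤) :
    J ⁅J z, y⁆ ∈ ascendingSeries 𝔤 k := by
  rw [← lie_map_of_mem_center hJ h.mem]
  exact h.lie_mem _

theorem lie_combination (h : IsCenterGenerator J z k) (hJ : IsComplexStructure J) (a b : ℝ)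
    (y : 𝔤) : ⁅J z, a • y + b • J y⁆ = a • ⁅J z, y⁆ + b • J ⁅J z, y⁆ := by
  rw [lie_add, lie_smul, lie_smul, lie_map_of_mem_center hJ h.mem]

theorem exists_lie_ne_zero (h : IsCenterGenerator J z k) (hS : IsSnN J) :
    ∃ q : 𝔤, ⁅J z, q⁆ ≠ 0 := by
  by_contra hcon
  push Not at hcon
  exact map_notMem_center hS h.mem h.ne_zero (mem_center_of_forall hcon)

/-- The image of `ad (J z)` commutes with `𝔤₂`, being contained in the derived algebra. -/
theorem lie_lie_eq_zero {x : 𝔤} (hx : x ∈ ascendingSeries 𝔤 2) (y : 𝔤) : ⁅⁅J z, y⁆, x⁆ = 0 := by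
  rw [← lie_skew, lie_lie_eq_zero_of_mem_two hx, neg_zero]

theorem map_lie_lie_eq_zero (h : IsCenterGenerator J z k) (hJ : IsComplexStructure J) {x : 𝔤}
    (hx : x ∈ ascendingSeries 𝔤 2) (y : 𝔤) : ⁅J ⁅J z, y⁆, x⁆ = 0 := by
  rw [← lie_map_of_mem_center hJ h.mem, lie_lie_eq_zero hx]

theorem map_mem_secondHull (h : IsCenterGenerator J z k) : J z ∈ secondHull J :=
  NLA.map_mem_secondHull (center_le_two h.mem)

/-- Otherwise `[J z, q]` would be a nonzero multiple of `z`, while `J [J z, q] = [J z, J q]` lies in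
`𝔤_k` and `J z` does not. -/
theorem notMem_centerHull (h : IsCenterGenerator J z k) (hJ : IsComplexStructure J) {q : 𝔤}
    (hq : ⁅J z, q⁆ ≠ 0) : ⁅J z, q⁆ ∉ centerHull J := by
  intro hmem
  obtain ⟨c, hc⟩ := h.exists_smul _ (h.mem_center_of_mem_centerHull hmem (h.lie_mem q))
  have h1 := h.map_lie_mem hJ q
  rw [hc, map_smul] at h1
  have hc0 : c ≠ 0 := by
    rintro rfl
    exact hq (by rw [hc, zero_smul])
  exact h.map_notMem ((Submodule.smul_mem_iff _ hc0).1 h1)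

/-! ### The case where `𝔤₂ + J 𝔤₂` has complex codimension one -/

theorem exists_eq_add [FiniteDimensional ℝ 𝔤]
    (h : IsCenterGenerator J z k) (hJ : IsComplexStructure J)
    (hdim : finrank ℝ 𝔤 = 8) (hV : finrank ℝ (secondHull J) = 6) {q : 𝔤} (hq : ⁅J z, q⁆ ≠ 0)
    (y : 𝔤) : ∃ v ∈ secondHull J, ∃ a b : ℝ, y = v + a • q + b • J q :=
  forall_exists_eq_add hJ (secondHull_isJInvariant hJ) (by omega)
    (fun hmem => hq (h.lie_hull q hmem)) y

theorem lie_map_eq [FiniteDimensional ℝ 𝔤] [LieRing.IsNilpotent 𝔤]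
    (h : IsCenterGenerator J z k) (hJ : IsComplexStructure J)
    (hdim : finrank ℝ 𝔤 = 8) (hV : finrank ℝ (secondHull J) = 6) {q : 𝔤} (hq : ⁅J z, q⁆ ≠ 0) :
    ⁅J ⁅J z, q⁆, q⁆ = ⁅⁅J z, q⁆, J q⁆ := by
  have h1 := h.lie_hull _ (lie_mem_of_codim_le_two (lie_mem_secondHull hJ hdim hV)
    (h.exists_eq_add hJ hdim hV hq) q (J q))
  rw [leibniz_lie, lie_map_of_mem_center hJ h.mem, ← lie_skew q] at h1
  rw [eq_comm, ← sub_eq_zero, sub_eq_add_neg, h1]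

/-- If `x ∈ 𝔤₂` and `J x ∈ 𝔤_k`, then only the brackets of `J x` with a complement of
`𝔤₂ + J 𝔤₂` have to be checked in order to see that `J x ∈ 𝔤₂`. -/
theorem map_mem_two [FiniteDimensional ℝ 𝔤]
    (h : IsCenterGenerator J z k) (hJ : IsComplexStructure J)
    (hdim : finrank ℝ 𝔤 = 8) (hV : finrank ℝ (secondHull J) = 6) {q : 𝔤} (hq : ⁅J z, q⁆ ≠ 0)
    {x : 𝔤} (hx : x ∈ ascendingSeries 𝔤 2) (hJx : J x ∈ ascendingSeries 𝔤 k)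
    (h1 : ⁅J x, q⁆ ∈ ascendingSeries 𝔤 1) (h2 : ⁅J x, J q⁆ ∈ ascendingSeries 𝔤 1) :
    J x ∈ ascendingSeries 𝔤 2 := by
  refine (mem_ascendingSeries_succ 1 _).2 fun y => ?_
  obtain ⟨v, hv, a, b, rfl⟩ := h.exists_eq_add hJ hdim hV hq y
  obtain ⟨c, hc, d, hd, rfl⟩ := mem_secondHull.1 hv
  rw [lie_add, lie_add, lie_add, lie_smul, lie_smul]
  exact add_mem (add_mem (add_mem (lie_mem_of_mem_succ' hc _)
    (h.mem_center_of_mem_centerHull (lie_map_map_mem_centerHull hJ hx hd)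
      (lie_mem_ascendingSeries k _ hJx _)))
    (Submodule.smul_mem _ _ h1)) (Submodule.smul_mem _ _ h2)

/-- If the complex line `[J z, 𝔤]` meets `𝔤₂`, it is contained in `𝔤₂`. -/
theorem map_lie_mem_two [FiniteDimensional ℝ 𝔤] [LieRing.IsNilpotent 𝔤]
    (h : IsCenterGenerator J z k) (hJ : IsComplexStructure J)
    (hdim : finrank ℝ 𝔤 = 8) (hV : finrank ℝ (secondHull J) = 6) {q : 𝔤} (hq : ⁅J z, q⁆ ≠ 0)
    (hq2 : ⁅J z, q⁆ ∈ ascendingSeries 𝔤 2) : J ⁅J z, q⁆ ∈ ascendingSeries 𝔤 2 := by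
  have h1 : ⁅J ⁅J z, q⁆, q⁆ ∈ ascendingSeries 𝔤 1 := by
    rw [h.lie_map_eq hJ hdim hV hq]
    exact lie_mem_of_mem_succ hq2 _
  refine h.map_mem_two hJ hdim hV hq hq2 (h.map_lie_mem hJ q) h1
    (h.mem_center_of_mem_centerHull ?_ (lie_mem_ascendingSeries k _ (h.map_lie_mem hJ q) _))
  rw [lie_map_map hJ]
  exact mem_centerHull.2 ⟨_, lie_mem_of_mem_succ hq2 _, _,
    add_mem h1 (lie_mem_of_mem_succ hq2 _), rfl⟩

theorem secondHull_inf_lt (h : IsCenterGenerator J z k) :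
    secondHull J ⊓ ascendingSeries 𝔤 k < secondHull J :=
  lt_of_le_of_ne inf_le_left fun heq =>
    h.map_notMem ((inf_eq_left.1 heq) h.map_mem_secondHull)

theorem sup_complexLine_le [FiniteDimensional ℝ 𝔤] [LieRing.IsNilpotent 𝔤]
    (h : IsCenterGenerator J z k) (hJ : IsComplexStructure J)
    (hdim : finrank ℝ 𝔤 = 8) (hV : finrank ℝ (secondHull J) = 6) (q : 𝔤) :
    ascendingSeries 𝔤 2 ⊔ complexLine J ⁅J z, q⁆ ≤ secondHull J ⊓ ascendingSeries 𝔤 k := by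
  have hqV : ⁅J z, q⁆ ∈ secondHull J := lie_mem_secondHull hJ hdim hV _ h.map_mem_secondHull _
  refine sup_le (le_inf two_le_secondHull h.two_le') fun x hx => ?_
  obtain ⟨a, b, rfl⟩ := mem_complexLine.1 hx
  exact ⟨add_mem (Submodule.smul_mem _ _ hqV)
    (Submodule.smul_mem _ _ (secondHull_isJInvariant hJ _ hqV)),
    add_mem (Submodule.smul_mem _ _ (h.lie_mem q)) (Submodule.smul_mem _ _ (h.map_lie_mem hJ q))⟩

/-- If `dim 𝔤₂ = 4`, then `[J z, 𝔤]` meets `𝔤₂` for dimension reasons. -/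
theorem exists_lie_mem_two [FiniteDimensional ℝ 𝔤] [LieRing.IsNilpotent 𝔤]
    (h : IsCenterGenerator J z k) (hJ : IsComplexStructure J)
    (hS : IsSnN J) (hdim : finrank ℝ 𝔤 = 8) (hV : finrank ℝ (secondHull J) = 6)
    (h4 : finrank ℝ (ascendingSeries 𝔤 2) = 4) :
    ∃ q, ⁅J z, q⁆ ≠ 0 ∧ ⁅J z, q⁆ ∈ ascendingSeries 𝔤 2 := by
  obtain ⟨q, hq⟩ := h.exists_lie_ne_zero hS
  by_contra hcon
  push Not at hcon
  have h1 := finrank_sup_complexLine_of_disjoint hJ hq (U := ascendingSeries 𝔤 2) (by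
    intro x hx hx2
    obtain ⟨a, b, rfl⟩ := mem_complexLine.1 hx
    by_contra hne
    rw [← h.lie_combination hJ] at hx2 hne
    exact hcon _ hne hx2)
  have h2 := Submodule.finrank_mono (h.sup_complexLine_le hJ hdim hV q)
  have h3 := Submodule.finrank_lt_finrank_of_lt h.secondHull_inf_lt
  omega

/-- If `dim 𝔤₂ = 4`, then `𝔤₂ + J 𝔤₂ ⊆ 𝔤₃`. -/
theorem secondHull_le_three_of_four [FiniteDimensional ℝ 𝔤] [LieRing.IsNilpotent 𝔤]
    (h : IsCenterGenerator J z k) (hJ : IsComplexStructure J)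
    (hS : IsSnN J) (hdim : finrank ℝ 𝔤 = 8) (hV : finrank ℝ (secondHull J) = 6)
    (h4 : finrank ℝ (ascendingSeries 𝔤 2) = 4) : secondHull J ≤ ascendingSeries 𝔤 3 := by
  obtain ⟨q, hq, hq2⟩ := h.exists_lie_mem_two hJ hS hdim hV h4
  have hJq2 := h.map_lie_mem_two hJ hdim hV hq hq2
  have hspan := h.exists_eq_add hJ hdim hV hq
  have hVI := lie_mem_secondHull hJ hdim hV
  have hTlie : ∀ y, ⁅J z, y⁆ ∈ ascendingSeries 𝔤 2 := by
    intro y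
    obtain ⟨v, hv, a, b, rfl⟩ := hspan y
    rw [add_assoc, lie_add, h.lie_hull v hv, zero_add, h.lie_combination hJ]
    exact add_mem (Submodule.smul_mem _ _ hq2) (Submodule.smul_mem _ _ hJq2)
  obtain ⟨B, hB⟩ : ∃ B, B = ascendingSeries 𝔤 2 ⊔ Submodule.span ℝ {J z} := ⟨_, rfl⟩
  have h2B : ascendingSeries 𝔤 2 ≤ B := hB ▸ le_sup_left
  have hTB : J z ∈ B := hB ▸ Submodule.mem_sup_right (Submodule.mem_span_singleton_self _)
  have hBV : B ≤ secondHull J := by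
    rw [hB]
    refine sup_le two_le_secondHull ?_
    rw [Submodule.span_singleton_le_iff_mem]
    exact h.map_mem_secondHull
  have hBfin : finrank ℝ B = 5 := by
    have h1 := Submodule.finrank_add_le_finrank_add_finrank (ascendingSeries 𝔤 2)
      (Submodule.span ℝ {J z})
    have h2 : finrank ℝ (Submodule.span ℝ {J z}) ≤ 1 := by
      simpa using finrank_span_le_card (R := ℝ) ({J z} : Set 𝔤)
    have h3 : ascendingSeries 𝔤 2 < B := lt_of_le_of_ne h2B fun heq =>
      h.ne_zero (eq_zero_of_map_mem_two hJ hS h.mem (heq ▸ hTB))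
    have h5 := Submodule.finrank_lt_finrank_of_lt h3
    rw [← hB] at h1
    omega
  have hB3 : B ≤ ascendingSeries 𝔤 3 := by
    rw [hB]
    refine sup_le (ascendingSeries_mono (by norm_num)) ?_
    rw [Submodule.span_singleton_le_iff_mem]
    exact (mem_ascendingSeries_succ 2 _).2 hTlie
  obtain ⟨x, hxV, hxB, hx⟩ := exists_mem_notMem_forall_lie_mem hVI (B := B) (fun hle => by
    have := Submodule.finrank_mono hle
    omega)
  obtain ⟨c, hc, d, hd, rfl⟩ := mem_secondHull.1 hxV
  have hdB : J d ∉ B := fun hmem => hxB (add_mem (h2B hc) hmem)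
  have hdlie : ∀ y, ⁅J d, y⁆ ∈ B := by
    intro y
    have h1 := hx y
    rwa [add_lie, Submodule.add_mem_iff_right _
      (h2B (center_le_two (lie_mem_of_mem_succ hc y)))] at h1
  have hVeq : B ⊔ Submodule.span ℝ {J d} = secondHull J := by
    refine Submodule.eq_of_le_of_finrank_le (sup_le hBV ?_) ?_
    · rw [Submodule.span_singleton_le_iff_mem]
      exact NLA.map_mem_secondHull hd
    · have h1 : B < B ⊔ Submodule.span ℝ {J d} := lt_of_le_of_ne le_sup_left fun heq =>
        hdB (heq ▸ Submodule.mem_sup_right (Submodule.mem_span_singleton_self _))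
      have := Submodule.finrank_lt_finrank_of_lt h1
      omega
  have hBmem : ∀ {y : 𝔤}, y ∈ B → ∃ σ ∈ ascendingSeries 𝔤 2, ∃ a : ℝ, y = σ + a • J z := by
    intro y hy
    rw [hB] at hy
    obtain ⟨σ, hσ, w, hw, rfl⟩ := Submodule.mem_sup.1 hy
    obtain ⟨a, rfl⟩ := Submodule.mem_span_singleton.1 hw
    exact ⟨σ, hσ, a, rfl⟩
  have hdV : ∀ v ∈ secondHull J, ⁅J d, v⁆ ∈ ascendingSeries 𝔤 1 := by
    intro v hv
    rw [← hVeq] at hv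
    obtain ⟨w, hw, u, hu, rfl⟩ := Submodule.mem_sup.1 hv
    obtain ⟨b, rfl⟩ := Submodule.mem_span_singleton.1 hu
    obtain ⟨σ, hσ, a, rfl⟩ := hBmem hw
    rw [lie_add, lie_add, lie_smul, lie_smul, lie_self, smul_zero, add_zero, ← lie_skew _ (J z),
      h.lie_hull _ (NLA.map_mem_secondHull hd), neg_zero, smul_zero, add_zero]
    exact lie_mem_of_mem_succ' hσ _
  obtain ⟨σ, hσ, a, h1⟩ := hBmem (hdlie q)
  obtain ⟨σ', hσ', b, h2⟩ := hBmem (hdlie (J q))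
  have h3 : (-b) • ⁅J z, q⁆ + a • J ⁅J z, q⁆ ∈ centerHull J := by
    have h4 := hdV _ (lie_mem_of_codim_le_two hVI hspan q (J q))
    have h5 := sub_mem (sub_mem h4 (lie_mem_of_mem_succ hσ (J q))) (lie_mem_of_mem_succ' hσ' q)
    refine center_le_centerHull ?_
    convert! h5 using 1
    rw [leibniz_lie, h1, h2, ← lie_map_of_mem_center hJ h.mem, lie_add, add_lie, smul_lie, lie_smul,
      ← lie_skew q (J z)]
    module
  obtain ⟨hb, ha⟩ := eq_zero_of_combination_mem hJ (centerHull_isJInvariant hJ)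
    (h.notMem_centerHull hJ hq) h3
  rw [neg_eq_zero] at hb
  rw [ha, zero_smul, add_zero] at h1
  rw [hb, zero_smul, add_zero] at h2
  rw [← hVeq]
  refine sup_le hB3 ?_
  rw [Submodule.span_singleton_le_iff_mem]
  refine (mem_ascendingSeries_succ 2 _).2 fun y => ?_
  obtain ⟨v, hv, α, β, rfl⟩ := hspan y
  rw [lie_add, lie_add, lie_smul, lie_smul, h1, h2]
  exact add_mem (add_mem (center_le_two (hdV v hv)) (Submodule.smul_mem _ _ hσ))
    (Submodule.smul_mem _ _ hσ')

/-- If `dim 𝔤₂ = 3`, then `𝔤₂` contains a complex line. Otherwise `[J z, 𝔤]` contains some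
`X + J Y ≠ 0` with `X, Y ∈ 𝔤₂` and `[J Y, 𝔤] ⊆ 𝔤₂`, and the Nijenhuis and Jacobi identities force
`J X` and `J Y` into `𝔤₂`. -/
theorem exists_map_mem_two_of_three [FiniteDimensional ℝ 𝔤] [LieRing.IsNilpotent 𝔤]
    (h : IsCenterGenerator J z k) (hJ : IsComplexStructure J)
    (hS : IsSnN J) (hdim : finrank ℝ 𝔤 = 8) (h3 : finrank ℝ (ascendingSeries 𝔤 2) = 3) :
    ∃ x ∈ ascendingSeries 𝔤 2, J x ∈ ascendingSeries 𝔤 2 ∧ x ≠ 0 := by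
  by_contra hcon
  push Not at hcon
  have hV : finrank ℝ (secondHull J) = 6 := by
    have h1 := Submodule.finrank_sup_add_finrank_inf_eq (ascendingSeries 𝔤 2)
      ((ascendingSeries 𝔤 2).map J)
    have h2 : ascendingSeries 𝔤 2 ⊓ (ascendingSeries 𝔤 2).map J = ⊥ := by
      rw [eq_bot_iff]
      intro x hx
      rw [mem_inf_map_iff hJ] at hx
      exact hcon x hx.1 hx.2
    rw [h2, finrank_bot, finrank_map_eq hJ, h3] at h1
    exact h1
  have hVI := lie_mem_secondHull hJ hdim hV
  have hnot2 : ∀ q, ⁅J z, q⁆ ≠ 0 → ⁅J z, q⁆ ∉ ascendingSeries 𝔤 2 := fun q hq hq2 =>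
    hq (hcon _ hq2 (h.map_lie_mem_two hJ hdim hV hq hq2))
  obtain ⟨q, X, hX, Y, hY, hq, hP, hYlie⟩ : ∃ q : 𝔤, ∃ X ∈ ascendingSeries 𝔤 2,
      ∃ Y ∈ ascendingSeries 𝔤 2, ⁅J z, q⁆ ≠ 0 ∧ ⁅J z, q⁆ = X + J Y ∧
        ∀ y, ⁅J Y, y⁆ ∈ ascendingSeries 𝔤 2 := by
    obtain ⟨q, hq⟩ := h.exists_lie_ne_zero hS
    have h1 := finrank_sup_complexLine_of_disjoint hJ hq (U := ascendingSeries 𝔤 2) (by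
      intro x hx hx2
      obtain ⟨a, b, rfl⟩ := mem_complexLine.1 hx
      by_contra hne
      rw [← h.lie_combination hJ] at hx2 hne
      exact hnot2 _ hne hx2)
    have h2 := Submodule.finrank_lt_finrank_of_lt h.secondHull_inf_lt
    have hH := Submodule.eq_of_le_of_finrank_le (h.sup_complexLine_le hJ hdim hV q) (by omega)
    obtain ⟨x, hxH, hx2, hx⟩ := exists_mem_notMem_forall_lie_mem
      (A := secondHull J ⊓ ascendingSeries 𝔤 k) (B := ascendingSeries 𝔤 2)
      (fun x hx y => ⟨hVI x hx.1 y, lie_mem_ascendingSeries k x hx.2 y⟩) (fun hle => by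
        refine hnot2 q hq (hle ?_)
        rw [← hH]
        exact Submodule.mem_sup_right (self_mem_complexLine _))
    rw [← hH] at hxH
    obtain ⟨σ, hσ, w, hw, rfl⟩ := Submodule.mem_sup.1 hxH
    obtain ⟨a, b, rfl⟩ := mem_complexLine.1 hw
    rw [← h.lie_combination hJ] at hx2 hx
    obtain ⟨X, hX, Y, hY, hP⟩ := mem_secondHull.1 (hVI _ h.map_mem_secondHull (a • q + b • J q))
    refine ⟨a • q + b • J q, X, hX, Y, hY, fun h0 => hx2 (by rwa [h0, add_zero]), hP, fun y => ?_⟩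
    have h4 := sub_mem (sub_mem (hx y) (center_le_two (lie_mem_of_mem_succ hσ y)))
      (center_le_two (lie_mem_of_mem_succ hX y))
    convert! h4 using 1
    rw [hP]
    simp only [add_lie]
    abel
  have hJPeq : J ⁅J z, q⁆ = J X - Y := by rw [hP, map_add, hJ.sq_eq_neg]; abel
  have hJXk : J X ∈ ascendingSeries 𝔤 k := by
    have := add_mem (h.map_lie_mem hJ q) (h.two_le' hY)
    rwa [hJPeq, sub_add_cancel] at this
  have hJYk : J Y ∈ ascendingSeries 𝔤 k := by
    have := sub_mem (h.lie_mem q) (h.two_le' hX)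
    rwa [hP, add_sub_cancel_left] at this
  have hr : ⁅J Y, q⁆ + ⁅Y, J q⁆ = 0 := by
    refine hcon _ (add_mem (hYlie q) (center_le_two (lie_mem_of_mem_succ hY _))) ?_
    have h1 := sub_mem (hYlie (J q)) (center_le_two (lie_mem_of_mem_succ hY q))
    rwa [lie_map_map hJ, add_sub_cancel_left] at h1
  have hYq : ⁅J Y, J q⁆ = ⁅Y, q⁆ := by rw [lie_map_map hJ, hr, map_zero, add_zero]
  have hXq : ⁅J X, q⁆ ∈ ascendingSeries 𝔤 1 := by
    have h1 := h.lie_map_eq hJ hdim hV hq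
    rw [hJPeq, hP, sub_lie, add_lie, hYq, sub_eq_iff_eq_add] at h1
    rw [h1]
    exact add_mem (add_mem (lie_mem_of_mem_succ hX _) (lie_mem_of_mem_succ hY _))
      (lie_mem_of_mem_succ hY _)
  have hY0 : Y = 0 := hcon Y hY (h.map_mem_two hJ hdim hV hq hY hJYk
    (by rw [eq_neg_of_add_eq_zero_left hr]; exact neg_mem (lie_mem_of_mem_succ hY _))
    (by rw [hYq]; exact lie_mem_of_mem_succ hY _))
  have hX0 : X = 0 := hcon X hX (h.map_mem_two hJ hdim hV hq hX hJXk hXq (by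
    refine h.mem_center_of_mem_centerHull ?_ (lie_mem_ascendingSeries k _ hJXk _)
    rw [lie_map_map hJ]
    exact mem_centerHull.2 ⟨_, lie_mem_of_mem_succ hX _, _,
      add_mem hXq (lie_mem_of_mem_succ hX _), rfl⟩))
  exact hq (by rw [hP, hX0, hY0, map_zero, add_zero])

/-! ### The case where `𝔤₂` is three-dimensional -/

theorem lie_eq_zero_of_mem_centerHull (h : IsCenterGenerator J z k) (hJ : IsComplexStructure J)
    {y : 𝔤} (hy : ⁅J z, y⁆ ∈ centerHull J) : ⁅J z, y⁆ = 0 :=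
  not_not.1 fun hne => h.notMem_centerHull hJ hne hy

end IsCenterGenerator

theorem notMem_centerHull_of_map_mem_two (hJ : IsComplexStructure J) (hS : IsSnN J) {e : 𝔤}
    (he : e ∈ ascendingSeries 𝔤 2) (hJe : J e ∈ ascendingSeries 𝔤 2) (he0 : e ≠ 0) :
    e ∉ centerHull J := fun hmem => he0 (eq_zero_of_map_mem_two hJ hS
  (mem_center_of_mem_two_of_mem_centerHull hJ hS he hmem) hJe)

theorem finrank_center_sup_complexLine [FiniteDimensional ℝ 𝔤] [LieRing.IsNilpotent 𝔤]
    (hJ : IsComplexStructure J) (hS : IsSnN J) (hdim : finrank ℝ 𝔤 = 8) {e : 𝔤}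
    (he : e ∈ ascendingSeries 𝔤 2) (hJe : J e ∈ ascendingSeries 𝔤 2) (he0 : e ≠ 0) :
    finrank ℝ (ascendingSeries 𝔤 1 ⊔ complexLine J e : Submodule ℝ 𝔤) = 3 := by
  rw [finrank_sup_complexLine_of_disjoint hJ he0,
    finrank_center_eq_one hJ hS hdim]
  intro x hx hx1
  obtain ⟨a, b, rfl⟩ := mem_complexLine.1 hx
  obtain ⟨rfl, rfl⟩ := eq_zero_of_combination_mem hJ (centerHull_isJInvariant hJ)
    (notMem_centerHull_of_map_mem_two hJ hS he hJe he0) (center_le_centerHull hx1)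
  simp

theorem center_sup_complexLine_le_two {e : 𝔤}
    (he : e ∈ ascendingSeries 𝔤 2) (hJe : J e ∈ ascendingSeries 𝔤 2) :
    ascendingSeries 𝔤 1 ⊔ complexLine J e ≤ ascendingSeries 𝔤 2 := by
  refine sup_le center_le_two ?_
  rw [complexLine, Submodule.span_le]
  rintro y (rfl | rfl)
  exacts [he, hJe]

theorem two_eq_of_three [FiniteDimensional ℝ 𝔤] [LieRing.IsNilpotent 𝔤]
    (hJ : IsComplexStructure J) (hS : IsSnN J) (hdim : finrank ℝ 𝔤 = 8)
    (h3 : finrank ℝ (ascendingSeries 𝔤 2) = 3) {e : 𝔤}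
    (he : e ∈ ascendingSeries 𝔤 2) (hJe : J e ∈ ascendingSeries 𝔤 2) (he0 : e ≠ 0) :
    ascendingSeries 𝔤 1 ⊔ complexLine J e = ascendingSeries 𝔤 2 :=
  Submodule.eq_of_le_of_finrank_le (center_sup_complexLine_le_two he hJe)
    (by rw [h3, finrank_center_sup_complexLine hJ hS hdim he hJe he0])

theorem secondHull_eq_of_three [FiniteDimensional ℝ 𝔤] [LieRing.IsNilpotent 𝔤]
    (hJ : IsComplexStructure J) (hS : IsSnN J) (hdim : finrank ℝ 𝔤 = 8)
    (h3 : finrank ℝ (ascendingSeries 𝔤 2) = 3) {e : 𝔤}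
    (he : e ∈ ascendingSeries 𝔤 2) (hJe : J e ∈ ascendingSeries 𝔤 2) (he0 : e ≠ 0) :
    secondHull J = centerHull J ⊔ complexLine J e := by
  have h2 := two_eq_of_three hJ hS hdim h3 he hJe he0
  have hWe := (centerHull_isJInvariant hJ).sup (complexLine_isJInvariant hJ e)
  have hle : ascendingSeries 𝔤 2 ≤ centerHull J ⊔ complexLine J e :=
    h2 ▸ sup_le_sup_right center_le_centerHull _
  refine le_antisymm (sup_le hle ?_) (sup_le centerHull_le_secondHull
    (complexLine_le (secondHull_isJInvariant hJ) (two_le_secondHull he)))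
  rintro _ ⟨x, hx, rfl⟩
  exact hWe x (hle hx)

theorem finrank_centerHull_eq_two [FiniteDimensional ℝ 𝔤] [LieRing.IsNilpotent 𝔤]
    (hJ : IsComplexStructure J) (hS : IsSnN J) (hdim : finrank ℝ 𝔤 = 8) :
    finrank ℝ (centerHull J) = 2 := by
  rw [finrank_centerHull hJ hS, finrank_center_eq_one hJ hS hdim]

theorem finrank_secondHull_of_three [FiniteDimensional ℝ 𝔤] [LieRing.IsNilpotent 𝔤]
    (hJ : IsComplexStructure J) (hS : IsSnN J) (hdim : finrank ℝ 𝔤 = 8)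
    (h3 : finrank ℝ (ascendingSeries 𝔤 2) = 3) {e : 𝔤}
    (he : e ∈ ascendingSeries 𝔤 2) (hJe : J e ∈ ascendingSeries 𝔤 2) (he0 : e ≠ 0) :
    finrank ℝ (secondHull J) = 4 := by
  rw [secondHull_eq_of_three hJ hS hdim h3 he hJe he0, finrank_sup_complexLine hJ
    (centerHull_isJInvariant hJ) (notMem_centerHull_of_map_mem_two hJ hS he hJe he0),
    finrank_centerHull_eq_two hJ hS hdim]

theorem mem_complexLine_of_three [FiniteDimensional ℝ 𝔤] [LieRing.IsNilpotent 𝔤]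
    (hJ : IsComplexStructure J) (hS : IsSnN J) (hdim : finrank ℝ 𝔤 = 8)
    (h3 : finrank ℝ (ascendingSeries 𝔤 2) = 3) {e : 𝔤}
    (he : e ∈ ascendingSeries 𝔤 2) (hJe : J e ∈ ascendingSeries 𝔤 2) (he0 : e ≠ 0) {x : 𝔤}
    (hx : x ∈ ascendingSeries 𝔤 2) (hJx : J x ∈ ascendingSeries 𝔤 2) : x ∈ complexLine J e := by
  have hle := center_sup_complexLine_le_two he hJe
  rw [← two_eq_of_three hJ hS hdim h3 he hJe he0] at hx
  obtain ⟨ζ, hζ, w, hw, rfl⟩ := Submodule.mem_sup.1 hx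
  have hJw := hle (Submodule.mem_sup_right (complexLine_isJInvariant hJ e w hw))
  rw [map_add, Submodule.add_mem_iff_left _ hJw] at hJx
  rw [eq_zero_of_map_mem_two hJ hS hζ hJx, zero_add]
  exact hw

namespace IsCenterGenerator

variable {z : 𝔤} {k : ℕ}

theorem exists_eq_add_smul_of_three [FiniteDimensional ℝ 𝔤] [LieRing.IsNilpotent 𝔤]
    (h : IsCenterGenerator J z k)
    (hJ : IsComplexStructure J) (hS : IsSnN J) (hdim : finrank ℝ 𝔤 = 8)
    (h3 : finrank ℝ (ascendingSeries 𝔤 2) = 3) {e : 𝔤}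
    (he : e ∈ ascendingSeries 𝔤 2) (hJe : J e ∈ ascendingSeries 𝔤 2) (he0 : e ≠ 0) {v : 𝔤}
    (hv : v ∈ secondHull J) : ∃ σ ∈ ascendingSeries 𝔤 2, ∃ c : ℝ, v = σ + c • J z := by
  rw [secondHull_eq_of_three hJ hS hdim h3 he hJe he0] at hv
  obtain ⟨w, hw, u, hu, rfl⟩ := Submodule.mem_sup.1 hv
  obtain ⟨a, ha, b, hb, rfl⟩ := mem_centerHull.1 hw
  obtain ⟨c, rfl⟩ := h.exists_smul b hb
  refine ⟨a + u, add_mem (center_le_two ha)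
    (center_sup_complexLine_le_two he hJe (Submodule.mem_sup_right hu)), c, ?_⟩
  rw [map_smul]
  abel

/-- The vector `x` below satisfies `[x, 𝔤] ⊆ 𝔤₂ + J 𝔤₂`; the Jacobi identities with `q`, `J q`
and `J x` remove the component of `[x, 𝔤]` along `J z`. -/
theorem mem_three_of_lie_mem_secondHull [FiniteDimensional ℝ 𝔤] [LieRing.IsNilpotent 𝔤]
    (h : IsCenterGenerator J z k)
    (hJ : IsComplexStructure J) (hS : IsSnN J) (hdim : finrank ℝ 𝔤 = 8)
    (h3 : finrank ℝ (ascendingSeries 𝔤 2) = 3) {q : 𝔤}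
    (he : ⁅J z, q⁆ ∈ ascendingSeries 𝔤 2) (hJe : J ⁅J z, q⁆ ∈ ascendingSeries 𝔤 2)
    (he0 : ⁅J z, q⁆ ≠ 0) {M : Submodule ℝ 𝔤}
    (hMV : ∀ m ∈ M, ∀ v ∈ secondHull J, ⁅m, v⁆ = 0)
    (hspan : ∀ y : 𝔤, ∃ m ∈ M, ∃ a b : ℝ, y = m + a • q + b • J q)
    (hqq : ⁅q, J q⁆ ∈ M) {x : 𝔤} (hxM : x ∈ M) (hJxM : J x ∈ M)
    (hMx : ∀ m ∈ M, ∃ v ∈ secondHull J, ∃ a b : ℝ, m = v + a • x + b • J x)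
    (hx : ∀ y, ⁅x, y⁆ ∈ secondHull J) (hJx : ∀ y, ⁅J x, y⁆ ∈ secondHull J) :
    x ∈ ascendingSeries 𝔤 3 := by
  have hmem : ⁅x, J x⁆ ∈ ascendingSeries 𝔤 1 := by
    have hcomm : ∀ y : 𝔤, ⁅y, ⁅x, J x⁆⁆ = 0 := by
      intro y
      have h1 : ⁅y, x⁆ ∈ secondHull J := by rw [← lie_skew]; exact neg_mem (hx y)
      have h2 : ⁅y, J x⁆ ∈ secondHull J := by rw [← lie_skew]; exact neg_mem (hJx y)
      rw [leibniz_lie, hMV x hxM _ h2, ← lie_skew, hMV _ hJxM _ h1, neg_zero, zero_add]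
    exact mem_center_of_forall fun y => by rw [← lie_skew, hcomm, neg_zero]
  have hxm : ∀ m ∈ M, ⁅x, m⁆ ∈ ascendingSeries 𝔤 1 := by
    intro m hm
    obtain ⟨v, hv, a, b, rfl⟩ := hMx m hm
    rw [lie_add, lie_add, lie_smul, lie_smul, lie_self, hMV x hxM v hv, smul_zero, zero_add,
      zero_add]
    exact Submodule.smul_mem _ _ hmem
  obtain ⟨σ, hσ, a, h1⟩ := h.exists_eq_add_smul_of_three hJ hS hdim h3 he hJe he0 (hx q)
  obtain ⟨σ', hσ', b, h2⟩ := h.exists_eq_add_smul_of_three hJ hS hdim h3 he hJe he0 (hx (J q))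
  have h4 : (-b) • ⁅J z, q⁆ + a • J ⁅J z, q⁆ ∈ centerHull J := by
    have h5 := sub_mem (sub_mem (hxm _ hqq) (lie_mem_of_mem_succ hσ (J q)))
      (lie_mem_of_mem_succ' hσ' q)
    refine center_le_centerHull ?_
    convert! h5 using 1
    rw [leibniz_lie, h1, h2, ← lie_map_of_mem_center hJ h.mem, lie_add, add_lie, smul_lie, lie_smul,
      ← lie_skew q (J z)]
    module
  obtain ⟨hb, ha⟩ := eq_zero_of_combination_mem hJ (centerHull_isJInvariant hJ)
    (h.notMem_centerHull hJ he0) h4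
  rw [neg_eq_zero] at hb
  rw [ha, zero_smul, add_zero] at h1
  rw [hb, zero_smul, add_zero] at h2
  refine (mem_ascendingSeries_succ 2 _).2 fun y => ?_
  obtain ⟨m, hm, α, β, rfl⟩ := hspan y
  rw [lie_add, lie_add, lie_smul, lie_smul, h1, h2]
  exact add_mem (add_mem (center_le_two (hxm m hm)) (Submodule.smul_mem _ _ hσ))
    (Submodule.smul_mem _ _ hσ')

/-- If `dim 𝔤₂ = 3` and `J z ∈ 𝔤₃`, then `𝔤₃` contains the centralizer of `J z`, which is a complex
subspace of complex codimension one. -/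
theorem exists_sup_complexLine_le_three [FiniteDimensional ℝ 𝔤] [LieRing.IsNilpotent 𝔤]
    (h : IsCenterGenerator J z k)
    (hJ : IsComplexStructure J) (hS : IsSnN J) (hdim : finrank ℝ 𝔤 = 8)
    (h3 : finrank ℝ (ascendingSeries 𝔤 2) = 3) (hz3 : J z ∈ ascendingSeries 𝔤 3) :
    ∃ x ∉ secondHull J, secondHull J ⊔ complexLine J x ≤ ascendingSeries 𝔤 3 := by
  obtain ⟨q, he0⟩ := h.exists_lie_ne_zero hS
  have hT2 : ∀ y, ⁅J z, y⁆ ∈ ascendingSeries 𝔤 2 := lie_mem_of_mem_succ hz3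
  have hJT2 : ∀ y, J ⁅J z, y⁆ ∈ ascendingSeries 𝔤 2 := fun y => by
    rw [← lie_map_of_mem_center hJ h.mem]; exact hT2 _
  obtain ⟨e, hedef⟩ : ∃ e, e = ⁅J z, q⁆ := ⟨_, rfl⟩
  have he := hT2 q
  have hJe := hJT2 q
  rw [← hedef] at he0 he hJe
  have hVJ := secondHull_isJInvariant hJ
  have hV4 := finrank_secondHull_of_three hJ hS hdim h3 he hJe he0
  have hVdec : ∀ {v : 𝔤}, v ∈ secondHull J → ∃ σ ∈ ascendingSeries 𝔤 2, ∃ c : ℝ, v = σ + c • J z :=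
    fun hv => h.exists_eq_add_smul_of_three hJ hS hdim h3 he hJe he0 hv
  have hVlie : ∀ v ∈ secondHull J, ∀ y : 𝔤, ⁅v, y⁆ ∈ ascendingSeries 𝔤 2 := by
    intro v hv y
    obtain ⟨σ, hσ, c, rfl⟩ := hVdec hv
    rw [add_lie, smul_lie]
    exact add_mem (center_le_two (lie_mem_of_mem_succ hσ y)) (Submodule.smul_mem _ _ (hT2 y))
  obtain ⟨M, hM⟩ : ∃ M : Submodule ℝ 𝔤, ∀ m, m ∈ M ↔ ⁅J z, m⁆ = 0 :=
    ⟨LinearMap.ker (LieAlgebra.ad ℝ 𝔤 (J z) : 𝔤 →ₗ[ℝ] 𝔤), fun m => by simp⟩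
  have hMJ : IsJInvariant J M := fun m hm => by
    rw [hM] at hm ⊢
    rw [lie_map_of_mem_center hJ h.mem, hm, map_zero]
  have hVM : secondHull J ≤ M := fun v hv => (hM v).2 (h.lie_hull v hv)
  have hqM : q ∉ M := by rw [hM, ← hedef]; exact he0
  have hTe : ∀ y, ∃ a b : ℝ, a • e + b • J e = ⁅J z, y⁆ := fun y =>
    mem_complexLine.1 (mem_complexLine_of_three hJ hS hdim h3 he hJe he0 (hT2 y) (hJT2 y))
  have hspan : ∀ y : 𝔤, ∃ m ∈ M, ∃ a b : ℝ, y = m + a • q + b • J q := by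
    intro y
    obtain ⟨a, b, hab⟩ := hTe y
    refine ⟨y - (a • q + b • J q), ?_, a, b, by abel⟩
    rw [hM, lie_sub, h.lie_combination hJ, ← hedef, hab, sub_self]
  have hM6 : finrank ℝ M = 6 := by
    have h1 := finrank_sup_complexLine hJ hMJ hqM
    have h2 : M ⊔ complexLine J q = ⊤ := by
      rw [eq_top_iff]
      intro y _
      exact mem_sup_complexLine.2 (hspan y)
    rw [h2, finrank_top, hdim] at h1
    omega
  have heM : ∀ m ∈ M, ⁅e, m⁆ = 0 := by
    intro m hm
    have h1 : ⁅J z, ⁅q, m⁆⁆ = ⁅e, m⁆ := by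
      rw [leibniz_lie, (hM m).1 hm, lie_zero, add_zero, hedef]
    rw [← h1]
    refine h.lie_eq_zero_of_mem_centerHull hJ ?_
    rw [h1]
    exact center_le_centerHull (lie_mem_of_mem_succ he _)
  have hstruct := lie_map_left_of_mem_two hJ hS he hJe
  have hJeM : ∀ m ∈ M, ⁅J e, m⁆ = 0 := fun m hm => by
    rw [(hstruct m).2, heM _ (hMJ m hm), neg_zero]
  have hMV : ∀ m ∈ M, ∀ v ∈ secondHull J, ⁅m, v⁆ = 0 := by
    intro m hm v hv
    obtain ⟨σ, hσ, c, rfl⟩ := hVdec hv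
    rw [← two_eq_of_three hJ hS hdim h3 he hJe he0] at hσ
    obtain ⟨ζ, hζ, a, b, rfl⟩ := mem_sup_complexLine.1 hσ
    rw [← lie_skew]
    simp only [add_lie, smul_lie, heM m hm, hJeM m hm, (hM m).1 hm, lie_eq_zero_of_mem_center hζ,
      smul_zero, add_zero, neg_zero]
  have hMI : ∀ m ∈ M, ∀ y : 𝔤, ⁅m, y⁆ ∈ M := by
    intro m hm y
    rw [hM, leibniz_lie, (hM m).1 hm, zero_lie, zero_add]
    exact hMV m hm _ (two_le_secondHull (hT2 y))
  have hqq := lie_mem_of_codim_le_two hMI hspan q (J q)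
  obtain ⟨x, hxM, hxV, hx⟩ := exists_mem_notMem_forall_lie_mem hMI (B := secondHull J)
    (fun hle => by
      have := Submodule.finrank_mono hle
      omega)
  have hMx : secondHull J ⊔ complexLine J x = M :=
    sup_complexLine_eq hJ hVJ hMJ hVM (by omega) hxM hxV
  have hMdec : ∀ m ∈ M, ∃ v ∈ secondHull J, ∃ a b : ℝ, m = v + a • x + b • J x := fun m hm => by
    rwa [← hMx, mem_sup_complexLine] at hm
  have hJx : ∀ y, ⁅J x, y⁆ ∈ secondHull J := by
    obtain ⟨w, hwM, hwB, hw⟩ := exists_mem_notMem_forall_lie_mem hMI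
      (B := secondHull J ⊔ Submodule.span ℝ {x}) (fun hle => by
        have h1 := Submodule.finrank_mono hle
        have h2 := Submodule.finrank_add_le_finrank_add_finrank (secondHull J)
          (Submodule.span ℝ {x})
        have h4 : finrank ℝ (Submodule.span ℝ {x}) ≤ 1 := by
          simpa using finrank_span_le_card (R := ℝ) ({x} : Set 𝔤)
        omega)
    obtain ⟨v, hv, a, b, rfl⟩ := hMdec w hwM
    have hb : b ≠ 0 := by
      rintro rfl
      refine hwB (Submodule.mem_sup.2 ⟨v, hv, a • x, ?_, by simp⟩)
      exact Submodule.smul_mem _ _ (Submodule.mem_span_singleton_self x)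
    have hJxB : ∀ y, ⁅J x, y⁆ ∈ secondHull J ⊔ Submodule.span ℝ {x} := by
      intro y
      have h1 := hw y
      rw [add_lie, add_lie, smul_lie, smul_lie, Submodule.add_mem_iff_right _
        (Submodule.mem_sup_left (add_mem (two_le_secondHull (hVlie v hv y))
          (Submodule.smul_mem _ _ (hx y))))] at h1
      exact (Submodule.smul_mem_iff _ hb).1 h1
    intro y
    obtain ⟨v₁, hv₁, w, hw, hw₁⟩ := Submodule.mem_sup.1 (hJxB y)
    obtain ⟨α, rfl⟩ := Submodule.mem_span_singleton.1 hw
    obtain ⟨v₂, hv₂, w, hw, hw₂⟩ := Submodule.mem_sup.1 (hJxB (J y))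
    obtain ⟨β, rfl⟩ := Submodule.mem_span_singleton.1 hw
    have h1 := lie_map_map hJ x y
    rw [← hw₁, ← hw₂] at h1
    have h2 : (-β) • x + α • J x ∈ secondHull J := by
      have h4 := sub_mem (sub_mem hv₂ (hx y)) (hVJ _ (add_mem hv₁ (hx (J y))))
      convert! h4 using 1
      simp only [map_add, map_smul] at h1 ⊢
      linear_combination (norm := module) h1.symm
    have ha := (eq_zero_of_combination_mem hJ hVJ hxV h2).2
    rw [← hw₁, ha, zero_smul, add_zero]
    exact hv₁
  rw [hedef] at he hJe he0
  have hx3 := h.mem_three_of_lie_mem_secondHull hJ hS hdim h3 he hJe he0 hMV hspan hqq hxM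
    (hMJ x hxM) hMdec hx hJx
  have hJx3 := h.mem_three_of_lie_mem_secondHull hJ hS hdim h3 he hJe he0 hMV hspan hqq
    (hMJ x hxM) (hMJ _ (hMJ x hxM)) (fun m hm => by
      obtain ⟨v, hv, a, b, rfl⟩ := hMdec m hm
      exact ⟨v, hv, b, -a, by rw [hJ.sq_eq_neg]; module⟩) hJx (fun y => by
      rw [hJ.sq_eq_neg, neg_lie]
      exact neg_mem (hx y))
  refine ⟨x, hxV, sup_le (fun v hv => (mem_ascendingSeries_succ 2 v).2 (hVlie v hv)) ?_⟩
  rw [complexLine, Submodule.span_le]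
  rintro y (rfl | rfl)
  exacts [hx3, hJx3]

/-- Suppose that `dim 𝔤₂ = 3` and `J z ∉ 𝔤₃`. Take `p = [J z, q]` to be the first element of
`[J z, 𝔤]` in the ascending central series lying outside `𝔤₂ + J 𝔤₂`. Then
`𝔤₂ + J 𝔤₂ + ⟨p, J p⟩` is an ideal, and the choice of `p` puts first `p` and then, by the Jacobi and
Nijenhuis identities, `J p` into `𝔤₃`. -/
theorem exists_three_eq_sup_complexLine [FiniteDimensional ℝ 𝔤] [LieRing.IsNilpotent 𝔤]
    (h : IsCenterGenerator J z k)
    (hJ : IsComplexStructure J) (hS : IsSnN J) (hdim : finrank ℝ 𝔤 = 8)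
    (h3 : finrank ℝ (ascendingSeries 𝔤 2) = 3) {e : 𝔤}
    (he : e ∈ ascendingSeries 𝔤 2) (hJe : J e ∈ ascendingSeries 𝔤 2) (he0 : e ≠ 0)
    (hz3 : J z ∉ ascendingSeries 𝔤 3) :
    ∃ p ∉ secondHull J, ascendingSeries 𝔤 3 = ascendingSeries 𝔤 2 ⊔ complexLine J p ∧
      secondHull J ⊔ complexLine J p ≤ ascendingSeries 𝔤 4 := by
  have hVJ := secondHull_isJInvariant hJ
  have hV4 := finrank_secondHull_of_three hJ hS hdim h3 he hJe he0
  have hVdec : ∀ {v : 𝔤}, v ∈ secondHull J → ∃ σ ∈ ascendingSeries 𝔤 2, ∃ c : ℝ, v = σ + c • J z :=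
    fun hv => h.exists_eq_add_smul_of_three hJ hS hdim h3 he hJe he0 hv
  have hVk : ∀ {v : 𝔤}, v ∈ secondHull J → v ∈ ascendingSeries 𝔤 k → v ∈ ascendingSeries 𝔤 2 := by
    intro v hv hvk
    obtain ⟨σ, hσ, c, rfl⟩ := hVdec hv
    rw [Submodule.add_mem_iff_right _ (h.two_le' hσ)] at hvk
    by_cases hc : c = 0
    · simpa [hc] using hσ
    · exact absurd ((Submodule.smul_mem_iff _ hc).1 hvk) h.map_notMem
  -- the choice of `p`
  obtain ⟨l, hl, p, ⟨q, hpdef⟩, hpl, hpV⟩ := exists_first_escape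
    (A := LinearMap.range (LieAlgebra.ad ℝ 𝔤 (J z) : 𝔤 →ₗ[ℝ] 𝔤)) (B := secondHull J) (by
      intro hle
      refine hz3 ((mem_ascendingSeries_succ 2 _).2 fun y => hVk (hle ⟨y, ?_⟩) (h.lie_mem y))
      simp)
  have hpdef' : ⁅J z, q⁆ = p := hpdef
  have hJpdef : ⁅J z, J q⁆ = J p := by rw [lie_map_of_mem_center hJ h.mem, hpdef']
  have hpk : p ∈ ascendingSeries 𝔤 k := hpdef' ▸ h.lie_mem q
  have hJpk : J p ∈ ascendingSeries 𝔤 k := hpdef' ▸ h.map_lie_mem hJ q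
  have hl2 : 2 ≤ l := by
    by_contra hlt
    exact hpV (two_le_secondHull (ascendingSeries_mono (by omega) hpl))
  have h1l : ascendingSeries 𝔤 1 ≤ ascendingSeries 𝔤 l := ascendingSeries_mono (by omega)
  have h2l : ascendingSeries 𝔤 2 ≤ ascendingSeries 𝔤 l := ascendingSeries_mono hl2
  have hlk : ascendingSeries 𝔤 l ≤ ascendingSeries 𝔤 k := by
    refine ascendingSeries_mono ?_
    by_contra hlt
    exact hpV (hl ⟨⟨q, hpdef⟩, ascendingSeries_mono (by omega) hpk⟩)
  have hIl : ∀ {y : 𝔤}, ⁅J z, y⁆ ∈ ascendingSeries 𝔤 l → ⁅J z, y⁆ ∈ ascendingSeries 𝔤 2 :=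
    fun {y} hy => hVk (hl ⟨⟨y, by simp⟩, hy⟩) (h.lie_mem y)
  -- `[J z, 𝔤] ∩ 𝔤₂` is `J`-invariant
  have hI2 : ∀ {y : 𝔤}, ⁅J z, y⁆ ∈ ascendingSeries 𝔤 2 → J ⁅J z, y⁆ ∈ ascendingSeries 𝔤 2 :=
    fun hy => hVk (hVJ _ (two_le_secondHull hy)) (h.map_lie_mem hJ _)
  have hv2 : ⁅J z, p⁆ ∈ ascendingSeries 𝔤 2 := hIl (lie_mem_of_mem_succ' hpl _)
  have hJv2 := hI2 hv2
  have hvJp : ⁅J z, J p⁆ = J ⁅J z, p⁆ := lie_map_of_mem_center hJ h.mem p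
  -- the complex subspace `M` turns out to be an ideal
  obtain ⟨M, hM⟩ : ∃ M, M = secondHull J ⊔ complexLine J p := ⟨_, rfl⟩
  have hMJ : IsJInvariant J M := hM ▸ hVJ.sup (complexLine_isJInvariant hJ p)
  have hM6 : finrank ℝ M = 6 := by rw [hM, finrank_sup_complexLine hJ hVJ hpV, hV4]
  have h2M : ascendingSeries 𝔤 2 ≤ M := hM ▸ two_le_secondHull.trans le_sup_left
  have hpM : p ∈ M := hM ▸ Submodule.mem_sup_right (self_mem_complexLine p)
  have hMdec : ∀ {m : 𝔤}, m ∈ M → ∃ σ ∈ ascendingSeries 𝔤 2, ∃ c a b : ℝ,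
      m = σ + c • J z + a • p + b • J p := by
    intro m hm
    rw [hM, mem_sup_complexLine] at hm
    obtain ⟨v, hv, a, b, rfl⟩ := hm
    obtain ⟨σ, hσ, c, rfl⟩ := hVdec hv
    exact ⟨σ, hσ, c, a, b, rfl⟩
  have hTM : ∀ m ∈ M, ⁅J z, m⁆ ∈ ascendingSeries 𝔤 2 := by
    intro m hm
    obtain ⟨σ, hσ, c, a, b, rfl⟩ := hMdec hm
    simp only [lie_add, lie_smul, lie_self, h.lie_hull _ (two_le_secondHull hσ), hvJp, smul_zero,
      zero_add]
    exact add_mem (Submodule.smul_mem _ _ hv2) (Submodule.smul_mem _ _ hJv2)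
  have hqM : q ∉ M := fun hq => hpV (two_le_secondHull (hpdef' ▸ hTM q hq))
  have hspan := forall_exists_eq_add hJ hMJ (by omega) hqM
  have hTmem : ∀ {y : 𝔤}, ⁅J z, y⁆ ∈ ascendingSeries 𝔤 2 → y ∈ M := by
    intro y hy
    obtain ⟨m, hm, a, b, rfl⟩ := hspan y
    rw [add_assoc, lie_add, h.lie_combination hJ, hpdef',
      Submodule.add_mem_iff_right _ (hTM m hm)] at hy
    obtain ⟨rfl, rfl⟩ := eq_zero_of_combination_mem hJ hVJ hpV (two_le_secondHull hy)
    simpa using hm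
  have hp2 : ∀ {x : 𝔤}, x ∈ ascendingSeries 𝔤 2 → ⁅p, x⁆ = 0 :=
    fun hx => hpdef' ▸ lie_lie_eq_zero hx q
  have hJp2 : ∀ {x : 𝔤}, x ∈ ascendingSeries 𝔤 2 → ⁅J p, x⁆ = 0 :=
    fun hx => hpdef' ▸ h.map_lie_lie_eq_zero hJ hx q
  have hpq : ⁅p, q⁆ ∈ M := by
    rw [← lie_skew]
    refine neg_mem (hTmem ?_)
    rw [leibniz_lie, hpdef', lie_self, zero_add]
    exact center_le_two (lie_mem_of_mem_succ' hv2 _)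
  have hJpJq : ⁅J p, J q⁆ ∈ M := by
    rw [← lie_skew]
    refine neg_mem (hTmem ?_)
    rw [leibniz_lie, hJpdef, lie_self, zero_add, hvJp]
    exact center_le_two (lie_mem_of_mem_succ' hJv2 _)
  have hTqJp : ⁅J z, ⁅q, J p⁆⁆ = ⁅p, J p⁆ + ⁅q, J ⁅J z, p⁆⁆ := by
    rw [leibniz_lie, hpdef', hvJp]
  have hqJv : ⁅q, J ⁅J z, p⁆⁆ ∈ ascendingSeries 𝔤 1 := lie_mem_of_mem_succ' hJv2 _
  have hTqJp2 : ⁅J z, ⁅q, J p⁆⁆ ∈ ascendingSeries 𝔤 2 := by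
    refine hIl ?_
    rw [hTqJp]
    exact add_mem (lie_mem_of_mem_succ hpl _) (h1l hqJv)
  have hpJp : ⁅p, J p⁆ ∈ ascendingSeries 𝔤 2 := by
    rwa [hTqJp, Submodule.add_mem_iff_left _ (center_le_two hqJv)] at hTqJp2
  have hJpq : ⁅J p, q⁆ ∈ M := by
    rw [← lie_skew]
    exact neg_mem (hTmem hTqJp2)
  have hpJq : ⁅p, J q⁆ ∈ M := by
    rw [← lie_skew]
    refine neg_mem (hTmem ?_)
    rw [leibniz_lie, hJpdef, ← lie_skew]
    exact add_mem (neg_mem hpJp) (center_le_two (lie_mem_of_mem_succ' hv2 _))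
  have hpm : ∀ m ∈ M, ⁅p, m⁆ ∈ ascendingSeries 𝔤 2 := by
    intro m hm
    obtain ⟨σ, hσ, c, a, b, rfl⟩ := hMdec hm
    simp only [lie_add, lie_smul, lie_self, hp2 hσ, smul_zero, zero_add, add_zero]
    refine add_mem (Submodule.smul_mem _ _ ?_) (Submodule.smul_mem _ _ hpJp)
    rw [← lie_skew]
    exact neg_mem hv2
  have hJpm : ∀ m ∈ M, ⁅J p, m⁆ ∈ ascendingSeries 𝔤 2 := by
    intro m hm
    obtain ⟨σ, hσ, c, a, b, rfl⟩ := hMdec hm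
    simp only [lie_add, lie_smul, lie_self, hJp2 hσ, smul_zero, zero_add, add_zero]
    refine add_mem (Submodule.smul_mem _ _ ?_) (Submodule.smul_mem _ _ ?_)
    · rw [← lie_skew, hvJp]
      exact neg_mem hJv2
    · rw [← lie_skew]
      exact neg_mem hpJp
  have hpy : ∀ y, ⁅p, y⁆ ∈ M := by
    intro y
    obtain ⟨m, hm, a, b, rfl⟩ := hspan y
    rw [lie_add, lie_add, lie_smul, lie_smul]
    exact add_mem (add_mem (h2M (hpm m hm)) (M.smul_mem _ hpq)) (M.smul_mem _ hpJq)
  have hTy : ∀ y, ⁅J z, y⁆ ∈ ascendingSeries 𝔤 2 ⊔ complexLine J p := by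
    intro y
    obtain ⟨m, hm, a, b, rfl⟩ := hspan y
    rw [add_assoc, lie_add, h.lie_combination hJ, hpdef']
    exact Submodule.add_mem_sup (hTM m hm) (mem_complexLine.2 ⟨a, b, rfl⟩)
  have hHM : ascendingSeries 𝔤 2 ⊔ complexLine J p ≤ M := sup_le h2M (complexLine_le hMJ hpM)
  have hMI : ∀ m ∈ M, ∀ y : 𝔤, ⁅m, y⁆ ∈ M := by
    intro m hm y
    have hJpy : ⁅J p, y⁆ ∈ M := by
      obtain ⟨m', hm', a, b, rfl⟩ := hspan y
      rw [lie_add, lie_add, lie_smul, lie_smul]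
      exact add_mem (add_mem (h2M (hJpm m' hm')) (M.smul_mem _ hJpq)) (M.smul_mem _ hJpJq)
    obtain ⟨σ, hσ, c, a, b, rfl⟩ := hMdec hm
    simp only [add_lie, smul_lie]
    exact add_mem (add_mem (add_mem (h2M (center_le_two (lie_mem_of_mem_succ hσ y)))
      (M.smul_mem _ (hHM (hTy y)))) (M.smul_mem _ (hpy y))) (M.smul_mem _ hJpy)
  have hMl : ∀ {m : 𝔤}, m ∈ M → m ∈ ascendingSeries 𝔤 l → m ∈ ascendingSeries 𝔤 2 := by
    intro m hm hml
    obtain ⟨σ, hσ, c, a, b, rfl⟩ := hMdec hm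
    have hc : c = 0 := by
      by_contra hc
      refine h.map_notMem ((Submodule.smul_mem_iff _ hc).1 ?_)
      have := sub_mem (sub_mem (sub_mem (hlk hml) (h.two_le' hσ)) (Submodule.smul_mem _ a hpk))
        (Submodule.smul_mem _ b hJpk)
      convert! this using 1
      abel
    subst hc
    rw [zero_smul, add_zero, add_assoc, ← hpdef', ← h.lie_combination hJ] at hml ⊢
    exact add_mem hσ (hIl ((Submodule.add_mem_iff_right _ (h2l hσ)).1 hml))
  have hp3 : ∀ y, ⁅p, y⁆ ∈ ascendingSeries 𝔤 2 := fun y => hMl (hpy y) (lie_mem_of_mem_succ hpl y)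
  -- the Jacobi identity for `J z`, `q`, `J q` and the Nijenhuis identity for `p`, `q`
  have hJpq2 : ⁅J p, q⁆ ∈ ascendingSeries 𝔤 2 := by
    have h1 := hTM _ (lie_mem_of_codim_le_two hMI hspan q (J q))
    rw [leibniz_lie, hpdef', hJpdef, Submodule.add_mem_iff_right _ (hp3 _)] at h1
    rw [← lie_skew]
    exact neg_mem h1
  have hJpJq2 : ⁅J p, J q⁆ ∈ ascendingSeries 𝔤 2 := by
    have h1 := lie_map_map hJ p q
    have h2 : J (⁅J p, q⁆ + ⁅p, J q⁆) = ⁅J p, J q⁆ - ⁅p, q⁆ := by rw [h1]; abel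
    rw [h1]
    refine add_mem (hp3 q) (hVk (hVJ _ (two_le_secondHull (add_mem hJpq2 (hp3 _)))) ?_)
    rw [h2]
    exact sub_mem (lie_mem_ascendingSeries k _ hJpk _) (h.two_le' (hp3 q))
  have hJp3 : ∀ y, ⁅J p, y⁆ ∈ ascendingSeries 𝔤 2 := by
    intro y
    obtain ⟨m, hm, a, b, rfl⟩ := hspan y
    rw [lie_add, lie_add, lie_smul, lie_smul]
    exact add_mem (add_mem (hJpm m hm) (Submodule.smul_mem _ _ hJpq2))
      (Submodule.smul_mem _ _ hJpJq2)
  have hpmem3 : p ∈ ascendingSeries 𝔤 3 := (mem_ascendingSeries_succ 2 _).2 hp3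
  have hJpmem3 : J p ∈ ascendingSeries 𝔤 3 := (mem_ascendingSeries_succ 2 _).2 hJp3
  have h23 : ascendingSeries 𝔤 2 ≤ ascendingSeries 𝔤 3 := ascendingSeries_mono (by norm_num)
  have hH3 : ascendingSeries 𝔤 2 ⊔ complexLine J p ≤ ascendingSeries 𝔤 3 := by
    refine sup_le h23 ?_
    rw [complexLine, Submodule.span_le]
    rintro y (rfl | rfl)
    exacts [hpmem3, hJpmem3]
  refine ⟨p, hpV, le_antisymm (fun y hy => ?_) hH3, fun m hm => ?_⟩
  · obtain ⟨σ, hσ, c, a, b, rfl⟩ := hMdec (hTmem (lie_mem_of_mem_succ' hy _))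
    have hc : c = 0 := by
      by_contra hc
      refine hz3 ((Submodule.smul_mem_iff _ hc).1 ?_)
      have := sub_mem (sub_mem (sub_mem hy (h23 hσ)) (Submodule.smul_mem _ a hpmem3))
        (Submodule.smul_mem _ b hJpmem3)
      convert! this using 1
      abel
    subst hc
    rw [zero_smul, add_zero]
    exact mem_sup_complexLine.2 ⟨σ, hσ, a, b, rfl⟩
  · rw [← hM] at hm
    refine (mem_ascendingSeries_succ 3 _).2 fun y => ?_
    obtain ⟨σ, hσ, c, a, b, rfl⟩ := hMdec hm
    simp only [add_lie, smul_lie]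
    exact add_mem (add_mem (add_mem (h23 (center_le_two (lie_mem_of_mem_succ hσ y)))
      (Submodule.smul_mem _ _ (hH3 (hTy y)))) (Submodule.smul_mem _ _ (h23 (hp3 y))))
      (Submodule.smul_mem _ _ (h23 (hJp3 y)))

end IsCenterGenerator

/-! ### Adapted splittings -/

theorem iSupIndep_of_sum_finrank_le [FiniteDimensional ℝ 𝔤] {n : ℕ} {U : Fin n → Submodule ℝ 𝔤}
    (htop : ⨆ i, U i = ⊤) (hsum : ∑ i, finrank ℝ (U i) ≤ finrank ℝ 𝔤) : iSupIndep U := by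
  classical
  rw [iSupIndep_iff_dfinsupp_lsum_injective]
  have hsurj : Function.Surjective (DFinsupp.lsum ℕ fun i => (U i).subtype) := by
    rw [← LinearMap.range_eq_top, ← Submodule.iSup_eq_range_dfinsupp_lsum, htop]
  have hfin : finrank ℝ (Π₀ i, U i) = ∑ i, finrank ℝ (U i) :=
    Module.finrank_directSum (R := ℝ) fun i => U i
  have h1 := LinearMap.finrank_le_finrank_of_surjective hsurj
  exact (LinearMap.injective_iff_surjective_of_finrank_eq_finrank (by omega)).2 hsurj

theorem iSup_fin_four (V₁ V₂ V₃ V₄ : Submodule ℝ 𝔤) :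
    ⨆ i, (![V₁, V₂, V₃, V₄] : Fin 4 → Submodule ℝ 𝔤) i = V₁ ⊔ V₂ ⊔ V₃ ⊔ V₄ := by
  refine le_antisymm (iSup_le fun i => ?_) ?_
  · fin_cases i
    exacts [le_sup_left.trans (le_sup_left.trans le_sup_left),
      le_sup_right.trans (le_sup_left.trans le_sup_left), le_sup_right.trans le_sup_left,
      le_sup_right]
  · exact sup_le (sup_le (sup_le (le_iSup ![V₁, V₂, V₃, V₄] 0) (le_iSup ![V₁, V₂, V₃, V₄] 1))
      (le_iSup ![V₁, V₂, V₃, V₄] 2)) (le_iSup ![V₁, V₂, V₃, V₄] 3)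

theorem iSup_fin_three (V₁ V₂ V₃ : Submodule ℝ 𝔤) :
    ⨆ i, (![V₁, V₂, V₃] : Fin 3 → Submodule ℝ 𝔤) i = V₁ ⊔ V₂ ⊔ V₃ := by
  refine le_antisymm (iSup_le fun i => ?_) ?_
  · fin_cases i
    exacts [le_sup_left.trans le_sup_left, le_sup_right.trans le_sup_left, le_sup_right]
  · exact sup_le (sup_le (le_iSup ![V₁, V₂, V₃] 0) (le_iSup ![V₁, V₂, V₃] 1))
      (le_iSup ![V₁, V₂, V₃] 2)

theorem iSup_fin_two (V₁ V₂ : Submodule ℝ 𝔤) :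
    ⨆ i, (![V₁, V₂] : Fin 2 → Submodule ℝ 𝔤) i = V₁ ⊔ V₂ := by
  refine le_antisymm (iSup_le fun i => ?_) ?_
  · fin_cases i
    exacts [le_sup_left, le_sup_right]
  · exact sup_le (le_iSup ![V₁, V₂] 0) (le_iSup ![V₁, V₂] 1)

theorem IsAdaptedSplitting.isDirectSum_three {V₁ V₂ V₃ V₄ W U₁ U₂ U₃ : Submodule ℝ 𝔤}
    (h : IsAdaptedSplitting J V₁ V₂ V₃ V₄) (h1 : U₁ ≤ V₁) (h2 : U₂ ≤ V₂) (h3 : U₃ ≤ V₃)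
    (hW : W = U₁ ⊔ U₂ ⊔ U₃) : IsDirectSum W ![U₁, U₂, U₃] := by
  refine ⟨?_, by rw [iSup_fin_three, hW]⟩
  refine (h.directSum.1.comp (f := ![0, 1, 2]) (by decide)).mono fun i => ?_
  fin_cases i
  exacts [h1, h2, h3]

theorem IsAdaptedSplitting.isDirectSum_two {V₁ V₂ V₃ V₄ W U₁ U₂ : Submodule ℝ 𝔤}
    (h : IsAdaptedSplitting J V₁ V₂ V₃ V₄) (h1 : U₁ ≤ V₁) (h2 : U₂ ≤ V₂)
    (hW : W = U₁ ⊔ U₂) : IsDirectSum W ![U₁, U₂] := by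
  refine ⟨?_, by rw [iSup_fin_two, hW]⟩
  refine (h.directSum.1.comp (f := ![0, 1]) (by decide)).mono fun i => ?_
  fin_cases i
  exacts [h1, h2]

/-- Two complex lines spanning, together with `𝔤₁ + J 𝔤₁`, a complex subspace of complex dimension
three can be completed to an adapted splitting. -/
theorem exists_isAdaptedSplitting [FiniteDimensional ℝ 𝔤] [LieRing.IsNilpotent 𝔤]
    (hJ : IsComplexStructure J) (hS : IsSnN J) (hdim : finrank ℝ 𝔤 = 8) {e p : 𝔤}
    (he : e ∉ centerHull J) (hp : p ∉ centerHull J ⊔ complexLine J e) :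
    ∃ V₄, IsAdaptedSplitting J (centerHull J) (complexLine J e) (complexLine J p) V₄ := by
  have hWJ := centerHull_isJInvariant hJ
  have hWe := hWJ.sup (complexLine_isJInvariant hJ e)
  have hWep := hWe.sup (complexLine_isJInvariant hJ p)
  have hW2 := finrank_centerHull_eq_two hJ hS hdim
  have h4 := finrank_sup_complexLine hJ hWJ he
  have h6 := finrank_sup_complexLine hJ hWe hp
  obtain ⟨r, hr⟩ := SetLike.exists_not_mem_of_ne_top
    (centerHull J ⊔ complexLine J e ⊔ complexLine J p) (fun htop => by
      rw [htop, finrank_top] at h6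
      omega) rfl
  have hne : ∀ {x : 𝔤} {U : Submodule ℝ 𝔤}, x ∉ U → x ≠ 0 := by
    rintro x U hx rfl
    exact hx (zero_mem _)
  have htop : centerHull J ⊔ complexLine J e ⊔ complexLine J p ⊔ complexLine J r = ⊤ :=
    sup_complexLine_eq hJ hWep (U' := ⊤) (fun _ _ => trivial) le_top
      (by rw [finrank_top]; omega) trivial hr
  have hfin : ∀ i, finrank ℝ (![centerHull J, complexLine J e, complexLine J p,
      complexLine J r] i) = 2 := by
    intro i
    fin_cases i
    exacts [hW2, finrank_complexLine hJ (hne he), finrank_complexLine hJ (hne hp),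
      finrank_complexLine hJ (hne hr)]
  have hsup : ⨆ i, (![centerHull J, complexLine J e, complexLine J p, complexLine J r] :
      Fin 4 → Submodule ℝ 𝔤) i = ⊤ := by rw [iSup_fin_four, htop]
  refine ⟨complexLine J r, ⟨iSupIndep_of_sum_finrank_le hsup ?_, hsup⟩, hfin, fun i => ?_,
    center_le_centerHull⟩
  · rw [Finset.sum_congr rfl fun i _ => hfin i, hdim]
    simp
  · fin_cases i
    exacts [hWJ, complexLine_isJInvariant hJ e, complexLine_isJInvariant hJ p,
      complexLine_isJInvariant hJ r]

/-- A complex line in `𝔤₂` and a vector of `𝔤₂` independent of it modulo the center are complex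
linearly independent modulo `𝔤₁ + J 𝔤₁`, because `𝔤₂` does not meet `J 𝔤₁`. -/
theorem notMem_centerHull_sup_complexLine (hJ : IsComplexStructure J) (hS : IsSnN J) {e y : 𝔤}
    (he : e ∈ ascendingSeries 𝔤 2) (hJe : J e ∈ ascendingSeries 𝔤 2)
    (hy : y ∈ ascendingSeries 𝔤 2) (hy' : y ∉ ascendingSeries 𝔤 1 ⊔ complexLine J e) :
    y ∉ centerHull J ⊔ complexLine J e := by
  intro hmem
  obtain ⟨w, hw, u, hu, rfl⟩ := Submodule.mem_sup.1 hmem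
  have hu2 := center_sup_complexLine_le_two he hJe (Submodule.mem_sup_right hu)
  exact hy' (Submodule.add_mem_sup (mem_center_of_mem_two_of_mem_centerHull hJ hS
    ((Submodule.add_mem_iff_left _ hu2).1 hy) hw) hu)

/-- If `𝔤₂ + J 𝔤₂` is six-dimensional and contained in `𝔤₃`, it is equal to `𝔤₃` unless `𝔤₃ = 𝔤`. -/
theorem three_isJInvariant_of_secondHull_le [FiniteDimensional ℝ 𝔤] [LieRing.IsNilpotent 𝔤]
    (hJ : IsComplexStructure J) (hdim : finrank ℝ 𝔤 = 8)
    (hV : finrank ℝ (secondHull J) = 6) (hle : secondHull J ≤ ascendingSeries 𝔤 3) :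
    IsJInvariant J (ascendingSeries 𝔤 3) ∧
      (finrank ℝ (ascendingSeries 𝔤 3) = 6 ∨ finrank ℝ (ascendingSeries 𝔤 3) = 8) := by
  rcases ascendingSeries_eq_top_or_eq hle (by omega) with h | h
  · rw [h, finrank_top]
    exact ⟨fun _ _ => trivial, Or.inr hdim⟩
  · rw [h]
    exact ⟨secondHull_isJInvariant hJ, Or.inl hV⟩

theorem finrank_secondHull_eq_six [FiniteDimensional ℝ 𝔤] [LieRing.IsNilpotent 𝔤]
    (hJ : IsComplexStructure J) (hS : IsSnN J) (hdim : finrank ℝ 𝔤 = 8)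
    (h4 : 4 ≤ finrank ℝ (ascendingSeries 𝔤 2)) : finrank ℝ (secondHull J) = 6 := by
  obtain ⟨z, k, h⟩ := exists_isCenterGenerator hJ hS hdim
  have h1 := finrank_secondHull_le hJ hS hdim
  have h2 := even_finrank_of_isJInvariant hJ (secondHull_isJInvariant hJ)
  have h3 : ascendingSeries 𝔤 2 < secondHull J := lt_of_le_of_ne two_le_secondHull fun heq =>
    h.ne_zero (eq_zero_of_map_mem_two hJ hS h.mem (heq ▸ h.map_mem_secondHull))
  have h5 := Submodule.finrank_lt_finrank_of_lt h3
  grind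

theorem finrank_two_inf_map [FiniteDimensional ℝ 𝔤] (hJ : IsComplexStructure J) :
    finrank ℝ (secondHull J) +
      finrank ℝ (ascendingSeries 𝔤 2 ⊓ (ascendingSeries 𝔤 2).map J : Submodule ℝ 𝔤) =
      finrank ℝ (ascendingSeries 𝔤 2) + finrank ℝ (ascendingSeries 𝔤 2) := by
  have := Submodule.finrank_sup_add_finrank_inf_eq (ascendingSeries 𝔤 2)
    ((ascendingSeries 𝔤 2).map J)
  rwa [finrank_map_eq hJ] at this

theorem exists_map_mem_two [FiniteDimensional ℝ 𝔤] [LieRing.IsNilpotent 𝔤]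
    (hJ : IsComplexStructure J) (hS : IsSnN J) (hdim : finrank ℝ 𝔤 = 8)
    (h4 : 4 ≤ finrank ℝ (ascendingSeries 𝔤 2)) :
    ∃ e ∈ ascendingSeries 𝔤 2, J e ∈ ascendingSeries 𝔤 2 ∧ e ≠ 0 := by
  have h1 := finrank_two_inf_map hJ
  rw [finrank_secondHull_eq_six hJ hS hdim h4] at h1
  obtain ⟨e, he, he0⟩ := Submodule.exists_mem_ne_zero_of_ne_bot
    (p := ascendingSeries 𝔤 2 ⊓ (ascendingSeries 𝔤 2).map J) (fun hbot => by
      rw [hbot, finrank_bot] at h1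
      omega)
  rw [mem_inf_map_iff hJ] at he
  exact ⟨e, he.1, he.2, he0⟩

theorem exists_splitting_of_finrank_two_eq_three [FiniteDimensional ℝ 𝔤] [LieRing.IsNilpotent 𝔤]
    (hJ : IsComplexStructure J) (hS : IsSnN J) (hdim : finrank ℝ 𝔤 = 8)
    (h3 : finrank ℝ (ascendingSeries 𝔤 2) = 3) :
    ∃ V₁ V₂ V₃ V₄ : Submodule ℝ 𝔤, IsAdaptedSplitting J V₁ V₂ V₃ V₄ ∧
      IsDirectSum (ascendingSeries 𝔤 2) ![ascendingSeries 𝔤 1, V₂] ∧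
      (ascendingSeries 𝔤 3 = ⊤ ∨
        (IsDirectSum (ascendingSeries 𝔤 3) ![V₁, V₂, V₃] ∧ ascendingSeries 𝔤 4 = ⊤) ∨
        (IsDirectSum (ascendingSeries 𝔤 3) ![ascendingSeries 𝔤 1, V₂, V₃] ∧
          ascendingSeries 𝔤 4 = ⊤) ∨
        (IsDirectSum (ascendingSeries 𝔤 3) ![ascendingSeries 𝔤 1, V₂, V₃] ∧
          IsDirectSum (ascendingSeries 𝔤 4) ![V₁, V₂, V₃] ∧ ascendingSeries 𝔤 5 = ⊤)) := by
  obtain ⟨z, k, h⟩ := exists_isCenterGenerator hJ hS hdim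
  obtain ⟨e, he, hJe, he0⟩ := h.exists_map_mem_two_of_three hJ hS hdim h3
  have heW := notMem_centerHull_of_map_mem_two hJ hS he hJe he0
  have h2 := two_eq_of_three hJ hS hdim h3 he hJe he0
  have hVeq := secondHull_eq_of_three hJ hS hdim h3 he hJe he0
  have hV4 := finrank_secondHull_of_three hJ hS hdim h3 he hJe he0
  have hVJ := secondHull_isJInvariant hJ
  -- a complex subspace of codimension two among the terms forces the next term to be everything
  have hnext : ∀ {p : 𝔤} {j : ℕ}, p ∉ secondHull J →
      ascendingSeries 𝔤 j = secondHull J ⊔ complexLine J p → ascendingSeries 𝔤 (j + 1) = ⊤ := by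
    intro p j hp hj
    refine ascendingSeries_succ_eq_top_of_isJInvariant hJ ?_ ?_
    · rw [hj]
      exact hVJ.sup (complexLine_isJInvariant hJ p)
    · rw [hj, finrank_sup_complexLine hJ hVJ hp]
      omega
  by_cases hz3 : J z ∈ ascendingSeries 𝔤 3
  · obtain ⟨p, hp, hle⟩ := h.exists_sup_complexLine_le_three hJ hS hdim h3 hz3
    obtain ⟨V₄, hsplit⟩ := exists_isAdaptedSplitting hJ hS hdim heW (hVeq ▸ hp)
    refine ⟨_, _, _, V₄, hsplit, hsplit.isDirectSum_two center_le_centerHull le_rfl h2.symm, ?_⟩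
    rcases ascendingSeries_eq_top_or_eq hle
      (by rw [finrank_sup_complexLine hJ hVJ hp]; omega) with htop | heq
    · exact Or.inl htop
    · exact Or.inr (Or.inl ⟨hsplit.isDirectSum_three le_rfl le_rfl le_rfl (hVeq ▸ heq),
        hnext hp heq⟩)
  · obtain ⟨p, hp, h3eq, hle⟩ := h.exists_three_eq_sup_complexLine hJ hS hdim h3 he hJe he0 hz3
    obtain ⟨V₄, hsplit⟩ := exists_isAdaptedSplitting hJ hS hdim heW (hVeq ▸ hp)
    refine ⟨_, _, _, V₄, hsplit, hsplit.isDirectSum_two center_le_centerHull le_rfl h2.symm, ?_⟩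
    have hds := hsplit.isDirectSum_three center_le_centerHull le_rfl le_rfl (h2 ▸ h3eq)
    rcases ascendingSeries_eq_top_or_eq hle
      (by rw [finrank_sup_complexLine hJ hVJ hp]; omega) with htop | heq
    · exact Or.inr (Or.inr (Or.inl ⟨hds, htop⟩))
    · exact Or.inr (Or.inr (Or.inr ⟨hds, hsplit.isDirectSum_three le_rfl le_rfl le_rfl
        (hVeq ▸ heq), hnext hp heq⟩))

theorem exists_splitting_of_finrank_two_eq_four [FiniteDimensional ℝ 𝔤] [LieRing.IsNilpotent 𝔤]
    (hJ : IsComplexStructure J) (hS : IsSnN J) (hdim : finrank ℝ 𝔤 = 8)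
    (h4 : finrank ℝ (ascendingSeries 𝔤 2) = 4) :
    ∃ V₁ V₂ V₃ V₄ : Submodule ℝ 𝔤, IsAdaptedSplitting J V₁ V₂ V₃ V₄ ∧
      ∃ Y ∈ V₃, Y ∉ (ascendingSeries 𝔤 1).map J ∧
        IsDirectSum (ascendingSeries 𝔤 2) ![ascendingSeries 𝔤 1, V₂, ℝ ∙ Y] := by
  obtain ⟨e, he, hJe, he0⟩ := exists_map_mem_two hJ hS hdim (by omega)
  have heW := notMem_centerHull_of_map_mem_two hJ hS he hJe he0
  have hle := center_sup_complexLine_le_two he hJe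
  have hfin := finrank_center_sup_complexLine hJ hS hdim he hJe he0
  obtain ⟨y, hy, hy'⟩ := SetLike.exists_of_lt (lt_of_le_of_ne hle fun heq => by
    rw [heq] at hfin
    omega)
  have hyW := notMem_centerHull_sup_complexLine hJ hS he hJe hy hy'
  obtain ⟨V₄, hsplit⟩ := exists_isAdaptedSplitting hJ hS hdim heW hyW
  have hspan : Submodule.span ℝ {y} ≤ complexLine J y := by
    rw [Submodule.span_singleton_le_iff_mem]
    exact self_mem_complexLine y
  refine ⟨_, _, _, V₄, hsplit, y, self_mem_complexLine y, fun hmem => hyW ?_,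
    hsplit.isDirectSum_three center_le_centerHull le_rfl hspan ?_⟩
  · exact Submodule.mem_sup_left (Submodule.mem_sup_right hmem)
  · have hle' : ascendingSeries 𝔤 1 ⊔ complexLine J e ⊔ Submodule.span ℝ {y} ≤
        ascendingSeries 𝔤 2 := by
      refine sup_le hle ?_
      rwa [Submodule.span_singleton_le_iff_mem]
    refine (Submodule.eq_of_le_of_finrank_le hle' ?_).symm
    have hlt : ascendingSeries 𝔤 1 ⊔ complexLine J e <
        ascendingSeries 𝔤 1 ⊔ complexLine J e ⊔ Submodule.span ℝ {y} :=
      lt_of_le_of_ne le_sup_left fun heq =>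
        hy' (heq ▸ Submodule.mem_sup_right (Submodule.mem_span_singleton_self y))
    have := Submodule.finrank_lt_finrank_of_lt hlt
    omega

theorem exists_splitting_of_finrank_two_eq_five [FiniteDimensional ℝ 𝔤] [LieRing.IsNilpotent 𝔤]
    (hJ : IsComplexStructure J) (hS : IsSnN J) (hdim : finrank ℝ 𝔤 = 8)
    (h5 : finrank ℝ (ascendingSeries 𝔤 2) = 5) :
    ∃ V₁ V₂ V₃ V₄ : Submodule ℝ 𝔤, IsAdaptedSplitting J V₁ V₂ V₃ V₄ ∧
      IsDirectSum (ascendingSeries 𝔤 2) ![ascendingSeries 𝔤 1, V₂, V₃] := by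
  obtain ⟨e, he, hJe, he0⟩ := exists_map_mem_two hJ hS hdim (by omega)
  have heW := notMem_centerHull_of_map_mem_two hJ hS he hJe he0
  have hV := finrank_secondHull_eq_six hJ hS hdim (by omega)
  have hfin := finrank_two_inf_map hJ
  have hle := center_sup_complexLine_le_two he hJe
  have hfin3 := finrank_center_sup_complexLine hJ hS hdim he hJe he0
  -- `𝔤₂ ∩ J 𝔤₂` is four-dimensional, hence not contained in `𝔤₁ + ⟨e, J e⟩`
  obtain ⟨p, hp, hp'⟩ : ∃ p ∈ ascendingSeries 𝔤 2 ⊓ (ascendingSeries 𝔤 2).map J,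
      p ∉ ascendingSeries 𝔤 1 ⊔ complexLine J e := by
    by_contra hcon
    push Not at hcon
    have := Submodule.finrank_mono hcon
    omega
  rw [mem_inf_map_iff hJ] at hp
  have hpW := notMem_centerHull_sup_complexLine hJ hS he hJe hp.1 hp'
  obtain ⟨V₄, hsplit⟩ := exists_isAdaptedSplitting hJ hS hdim heW hpW
  refine ⟨_, _, _, V₄, hsplit, hsplit.isDirectSum_three center_le_centerHull le_rfl le_rfl ?_⟩
  have hpU : complexLine J p ≤ ascendingSeries 𝔤 2 :=
    le_sup_right.trans (center_sup_complexLine_le_two hp.1 hp.2)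
  have hdisj : ∀ x ∈ complexLine J p, x ∈ ascendingSeries 𝔤 1 ⊔ complexLine J e → x = 0 := by
    intro x hx hxU
    obtain ⟨a, b, rfl⟩ := mem_complexLine.1 hx
    have hle' : ascendingSeries 𝔤 1 ⊔ complexLine J e ≤ centerHull J ⊔ complexLine J e :=
      sup_le_sup_right center_le_centerHull _
    obtain ⟨rfl, rfl⟩ := eq_zero_of_combination_mem hJ ((centerHull_isJInvariant hJ).sup
      (complexLine_isJInvariant hJ e)) hpW (hle' hxU)
    simp
  have hp0 : p ≠ 0 := by
    rintro rfl
    exact hp' (zero_mem _)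
  refine (Submodule.eq_of_le_of_finrank_le (sup_le hle hpU) ?_).symm
  rw [finrank_sup_complexLine_of_disjoint hJ hp0 hdisj]
  omega

end NLA

theorem mainTheorem11 {𝔤 : Type*} [LieRing 𝔤] [LieAlgebra ℝ 𝔤] [LieRing.IsNilpotent 𝔤]
    (hdim : finrank ℝ 𝔤 = 8) (J : 𝔤 →ₗ[ℝ] 𝔤) (hJ : IsComplexStructure J) (hS : IsSnN J) :
    (finrank ℝ (ascendingSeries 𝔤 2) = 3 →
      finrank ℝ (ascendingSeries 𝔤 1) = 1 ∧
      ∃ V₁ V₂ V₃ V₄ : Submodule ℝ 𝔤, IsAdaptedSplitting J V₁ V₂ V₃ V₄ ∧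
        IsDirectSum (ascendingSeries 𝔤 2) ![ascendingSeries 𝔤 1, V₂] ∧
        (ascendingSeries 𝔤 3 = ⊤ ∨
          (IsDirectSum (ascendingSeries 𝔤 3) ![V₁, V₂, V₃] ∧ ascendingSeries 𝔤 4 = ⊤) ∨
          (IsDirectSum (ascendingSeries 𝔤 3) ![ascendingSeries 𝔤 1, V₂, V₃] ∧
            ascendingSeries 𝔤 4 = ⊤) ∨
          (IsDirectSum (ascendingSeries 𝔤 3) ![ascendingSeries 𝔤 1, V₂, V₃] ∧
            IsDirectSum (ascendingSeries 𝔤 4) ![V₁, V₂, V₃] ∧ ascendingSeries 𝔤 5 = ⊤))) ∧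
    (finrank ℝ (ascendingSeries 𝔤 2) = 4 →
      finrank ℝ (ascendingSeries 𝔤 1) = 1 ∧
      (∃ V₁ V₂ V₃ V₄ : Submodule ℝ 𝔤, IsAdaptedSplitting J V₁ V₂ V₃ V₄ ∧
        ∃ Y ∈ V₃, Y ∉ (ascendingSeries 𝔤 1).map J ∧
          IsDirectSum (ascendingSeries 𝔤 2) ![ascendingSeries 𝔤 1, V₂, ℝ ∙ Y]) ∧
      IsJInvariant J (ascendingSeries 𝔤 3) ∧
      (finrank ℝ (ascendingSeries 𝔤 3) = 6 ∨ finrank ℝ (ascendingSeries 𝔤 3) = 8)) ∧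
    (finrank ℝ (ascendingSeries 𝔤 2) = 5 →
      finrank ℝ (ascendingSeries 𝔤 1) = 1 ∧
      (∃ V₁ V₂ V₃ V₄ : Submodule ℝ 𝔤, IsAdaptedSplitting J V₁ V₂ V₃ V₄ ∧
        IsDirectSum (ascendingSeries 𝔤 2) ![ascendingSeries 𝔤 1, V₂, V₃]) ∧
      IsJInvariant J (ascendingSeries 𝔤 3)) := by
  have : FiniteDimensional ℝ 𝔤 := FiniteDimensional.of_finrank_pos (by omega)
  have h1 := finrank_center_eq_one hJ hS hdim
  obtain ⟨z, k, h⟩ := exists_isCenterGenerator hJ hS hdim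
  refine ⟨fun h3 => ⟨h1, exists_splitting_of_finrank_two_eq_three hJ hS hdim h3⟩,
    fun h4 => ?_, fun h5 => ?_⟩
  · have hV := finrank_secondHull_eq_six hJ hS hdim h4.ge
    exact ⟨h1, exists_splitting_of_finrank_two_eq_four hJ hS hdim h4,
      three_isJInvariant_of_secondHull_le hJ hdim hV
        (h.secondHull_le_three_of_four hJ hS hdim hV h4)⟩
  · have hV := finrank_secondHull_eq_six hJ hS hdim (by omega)
    exact ⟨h1, exists_splitting_of_finrank_two_eq_five hJ hS hdim h5,
      (three_isJInvariant_of_secondHull_le hJ hdim hV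
        (secondHull_le_three_of_five hJ hdim hV h5)).1⟩
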